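/- Let $G$ be a compact (Hausdorff) group and let $\widehat G$ be the set of equivalence classes of its continuous irreducible unitary representations $\pi : G\to M_{d_\pi}$. A central weight on $\widehat G$ is a function $\omega:\widehat G\to(\delta,\infty)$, for some $\delta>0$, such that $\omega(\sigma)\le\omega(\pi)\omega(\pi')$ whenever $\sigma,\pi,\pi'\in\widehat G$ and $\sigma$ appears in the decomposition of $\pi\otimes\pi'$ into irreducible representations. Let $VN(G)=\ell^\infty\text{-}\bigoplus_{\pi\in\widehat G}M_{d_\pi}$, $\lambda(s)=(\pi(s))_\pi\in VN(G)$ for $s\in G$, $W=\bigoplus_\pi\omega(\pi)1_{M_{d_\pi}}$ and $W^{-1}=\bigoplus_\pi\omega(\pi)^{-1}1_{M_{d_\pi}}\in VN(G)$. The Beurling-Fourier algebra is the space of continuous functions $$A(G,\omega)=\{W^{-1}\varphi : \varphi\in VN(G)_*\},\qquad (W^{-1}\varphi)(s)=\varphi(\lambda(s)W^{-1})\quad(s\in G),$$ with the operator space structure of the predual of $VN(G,\omega^{-1})=\{AW: A\in VN(G)\}$, where $A\mapsto AW$ is a complete isometry of $VN(G)$ onto $VN(G,\omega^{-1})$ and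 $\langle W^{-1}\varphi,AW\rangle=\varphi(A)$; that is, $\|[W^{-1}\varphi_{ij}]\|_{M_n(A(G,\omega))}$ is the completely bounded norm of $VN(G)\to M_n$, $A\mapsto[\varphi_{ij}(A)]$. Let $\mathcal T(G)$ be the span of the coefficient functions $\pi_{ij}$, $\pi\in\widehat G$. Let $\omega$ be a central weight on $\widehat G$ and let $H$ be a closed subgroup of $G$. Say that $\pi\in\widehat G$ extends $\tau\in\widehat H$ if $\tau$ appears in the decomposition of $\pi|_H$ into irreducible representations, and put $$\omega_H(\tau)=\inf\{\omega(\pi):\pi\in\widehat G\text{ extends }\tau\}\qquad(\tau\in\widehat H).$$ Then: (i) $\omega_H$ is a central weight on $\widehat H$ (in particular, the infimum is over a non-empty set). (ii) $\mathcal T(G)\subseteq A(G,\omega)$, and the restriction map $\mathcal T(G)\to\mathcal T(H)$, $f\mapsto f|_H$, extends to a complete quotient map from $A(G,\omega)$ onto $A(H,\omega_H)$, which is again given by $f\mapsto f|_H$; here a linear map is a complete quotient map if, for every $n$, its $n$-th amplification maps the open unit ball of $M_n(A(G,\omega))$ onto the open unit ball of $M_n(A(H,\omega_H))$. -/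

import Mathlib

open scoped ENNReal Matrix Kronecker Matrix.Norms.L2Operator

noncomputable section

namespace BeurlingFourier

universe u

section Representations

/-- Continuous finite-dimensional unitary representations of `G` in matrix form, on the
Hilbert space `ℂ^ι`. -/
abbrev UnitaryRep (G : Type u) [Group G] [TopologicalSpace G]
    (ι : Type*) [Fintype ι] [DecidableEq ι] :=
  G →ₜ* Matrix.unitaryGroup ι ℂ

namespace UnitaryRep

variable {G : Type u} [Group G] [TopologicalSpace G]
variable {ι κ : Type*} [Fintype ι] [DecidableEq ι] [Fintype κ] [DecidableEq κ]

/-- The matrix `ρ(g)`. -/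
def mat (ρ : UnitaryRep G ι) (g : G) : Matrix ι ι ℂ := (ρ g : Matrix ι ι ℂ)

/-- `ρ` is irreducible: the space is nonzero and the only invariant subspaces are trivial. -/
def IsIrreducible (ρ : UnitaryRep G ι) : Prop :=
  Nonempty ι ∧ ∀ V : Submodule ℂ (ι → ℂ),
    (∀ g : G, ∀ v ∈ V, ρ.mat g *ᵥ v ∈ V) → V = ⊥ ∨ V = ⊤

/-- `σ` is unitarily equivalent to a subrepresentation of `ρ`: there is an isometric
intertwiner from the space of `σ` to the space of `ρ`. For irreducible `σ` this says that `σ`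
appears in the decomposition of `ρ` into irreducible representations. -/
def IsContainedIn (σ : UnitaryRep G κ) (ρ : UnitaryRep G ι) : Prop :=
  ∃ V : Matrix ι κ ℂ, Vᴴ * V = 1 ∧ ∀ g : G, V * σ.mat g = ρ.mat g * V

/-- Unitary equivalence. -/
def IsEquivalent (σ : UnitaryRep G κ) (ρ : UnitaryRep G ι) : Prop :=
  ∃ U : Matrix ι κ ℂ, Uᴴ * U = 1 ∧ U * Uᴴ = 1 ∧ ∀ g : G, U * σ.mat g = ρ.mat g * U

/-- The tensor product representation `(σ ⊗ ρ)(g) = σ(g) ⊗ ρ(g)`. -/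
def tensor (σ : UnitaryRep G κ) (ρ : UnitaryRep G ι) : UnitaryRep G (κ × ι) where
  toFun g := ⟨σ.mat g ⊗ₖ ρ.mat g, Matrix.kronecker_mem_unitary (σ g).2 (ρ g).2⟩
  map_one' := by
    apply Subtype.ext
    simp [mat]
  map_mul' g h := by
    apply Subtype.ext
    simp [mat, Matrix.mul_kronecker_mul]
  continuous_toFun := by
    refine Continuous.subtype_mk ?_ _
    refine continuous_matrix fun a b => ?_
    have h1 : Continuous fun g => (σ g : Matrix κ κ ℂ) :=
      continuous_subtype_val.comp σ.continuous_toFun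
    have h2 : Continuous fun g => (ρ g : Matrix ι ι ℂ) :=
      continuous_subtype_val.comp ρ.continuous_toFun
    exact (h1.matrix_elem a.1 b.1).mul (h2.matrix_elem a.2 b.2)

/-- The restriction of a representation of `G` to a subgroup `H`. -/
def restrict (ρ : UnitaryRep G ι) (H : Subgroup G) : UnitaryRep H ι where
  toFun h := ρ (h : G)
  map_one' := by simp
  map_mul' g h := by simp
  continuous_toFun := ρ.continuous_toFun.comp continuous_subtype_val

end UnitaryRep

/-- Continuous irreducible unitary matrix representations of `G`. -/
structure Irrep (G : Type u) [Group G] [TopologicalSpace G] where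
  dim : ℕ
  rep : UnitaryRep G (Fin dim)
  irreducible : rep.IsIrreducible

/-- Unitary equivalence of irreducible representations. -/
instance irrepSetoid (G : Type u) [Group G] [TopologicalSpace G] : Setoid (Irrep G) where
  r σ ρ := σ.rep.IsEquivalent ρ.rep
  iseqv :=
    { refl := fun σ => ⟨1, by simp, by simp, fun g => by simp⟩
      symm := by
        rintro σ ρ ⟨U, h1, h2, h3⟩
        refine ⟨Uᴴ, by simpa using h2, by simpa using h1, fun g => ?_⟩
        calc Uᴴ * ρ.rep.mat g = Uᴴ * (ρ.rep.mat g * U) * Uᴴ := by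
              rw [Matrix.mul_assoc, Matrix.mul_assoc, h2, Matrix.mul_one]
          _ = σ.rep.mat g * Uᴴ := by
              rw [← h3 g, ← Matrix.mul_assoc, h1, Matrix.one_mul]
      trans := by
        rintro σ ρ τ ⟨U, h1, h2, h3⟩ ⟨V, k1, k2, k3⟩
        refine ⟨V * U, ?_, ?_, fun g => ?_⟩
        · rw [Matrix.conjTranspose_mul, Matrix.mul_assoc, ← Matrix.mul_assoc Vᴴ, k1,
            Matrix.one_mul, h1]
        · rw [Matrix.conjTranspose_mul, Matrix.mul_assoc, ← Matrix.mul_assoc U, h2,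
            Matrix.one_mul, k2]
        · rw [Matrix.mul_assoc, h3 g, ← Matrix.mul_assoc, k3 g, Matrix.mul_assoc] }

/-- The dual `Ĝ` of a compact group `G`: equivalence classes of continuous irreducible unitary
representations (all of them are finite-dimensional since `G` is compact). -/
def Dual (G : Type u) [Group G] [TopologicalSpace G] : Type u :=
  Quotient (irrepSetoid G)

namespace Dual

variable {G : Type u} [Group G] [TopologicalSpace G]

/-- A fixed matrix representation in the class `π`. -/
def irrep (π : Dual G) : Irrep G := Quotient.out π

/-- The dimension `d_π`. -/
def dim (π : Dual G) : ℕ := π.irrep.dim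

/-- The fixed representation `π : G → U(d_π)`. -/
def rep (π : Dual G) : UnitaryRep G (Fin π.dim) := π.irrep.rep

/-- `σ ∈ supp ρ`. -/
def MemSupp {ι : Type*} [Fintype ι] [DecidableEq ι] (σ : Dual G) (ρ : UnitaryRep G ι) : Prop :=
  σ.rep.IsContainedIn ρ

/-- `π ∈ Ĝ` is an extension of `τ ∈ Ĥ`: `τ` is in the support of the restriction of `π` to `H`. -/
def Extends {H : Subgroup G} (π : Dual G) (τ : Dual H) : Prop :=
  τ.MemSupp (π.rep.restrict H)

end Dual

end Representations

section Weights

variable {G : Type u} [Group G] [TopologicalSpace G]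

/-- `ω` is a central weight on `Ĝ`: it takes its values in `(δ, ∞)` for some `δ > 0`, and
`ω(σ) ≤ ω(π) ω(π')` whenever `σ` is in the support of `π ⊗ π'`. -/
structure IsCentralWeight (ω : Dual G → ℝ) : Prop where
  bounded_away : ∃ δ : ℝ, 0 < δ ∧ ∀ π, δ < ω π
  submul : ∀ σ π π' : Dual G, σ.MemSupp (π.rep.tensor π'.rep) → ω σ ≤ ω π * ω π'

/-- `ω_H(τ) = inf {ω(π) : π extends τ}`. -/
def restrictWeight (ω : Dual G → ℝ) (H : Subgroup G) (τ : Dual H) : ℝ :=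
  sInf (ω '' {π : Dual G | π.Extends τ})

end Weights

section Algebras

/-- The von Neumann algebra `VN(G)` of a compact group, in its representation as the
`ℓ^∞`-direct sum of the full matrix algebras `M_{d_π}`, `π ∈ Ĝ` (operator norms). -/
abbrev VN (G : Type u) [Group G] [TopologicalSpace G] :=
  lp (fun π : Dual G => Matrix (Fin π.dim) (Fin π.dim) ℂ) ∞

variable {G : Type u} [Group G] [TopologicalSpace G]

theorem norm_le_one_of_mem_unitary {ι : Type*} [Fintype ι] [DecidableEq ι] {U : Matrix ι ι ℂ}
    (hU : U ∈ Matrix.unitaryGroup ι ℂ) : ‖U‖ ≤ 1 := by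
  have h1 : ‖(1 : Matrix ι ι ℂ)‖ ≤ 1 := by
    have h := CStarRing.norm_star_mul_self (x := (1 : Matrix ι ι ℂ))
    rw [star_one, one_mul] at h
    nlinarith [norm_nonneg (1 : Matrix ι ι ℂ)]
  have h := CStarRing.norm_star_mul_self (x := U)
  rw [Matrix.mem_unitaryGroup_iff'.1 hU] at h
  nlinarith [norm_nonneg U]

/-- The unitary `λ(s) = (π(s))_π ∈ VN(G)`. -/
def lam (s : G) : VN G :=
  ⟨fun π => π.rep.mat s, by
    refine memℓp_infty ⟨1, ?_⟩
    rintro _ ⟨π, rfl⟩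
    exact norm_le_one_of_mem_unitary (π.rep s).2⟩

/-- The element `W⁻¹ = ⊕ ω(π)⁻¹ 1` of `VN(G)`, where `W = ⊕ ω(π) 1`. -/
def invWeight {ω : Dual G → ℝ} (hω : IsCentralWeight ω) : VN G :=
  ⟨fun π => ((ω π : ℂ)⁻¹) • (1 : Matrix (Fin π.dim) (Fin π.dim) ℂ), by
    obtain ⟨δ, hδ, h⟩ := hω.bounded_away
    refine memℓp_infty ⟨δ⁻¹, ?_⟩
    rintro _ ⟨π, rfl⟩
    have h0 : 0 < ω π := hδ.trans (h π)
    have h1 : ‖(1 : Matrix (Fin π.dim) (Fin π.dim) ℂ)‖ ≤ 1 :=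
      norm_le_one_of_mem_unitary (one_mem _)
    have h2 : ‖((ω π : ℂ)⁻¹)‖ ≤ δ⁻¹ := by
      rw [norm_inv, Complex.norm_real, Real.norm_of_nonneg h0.le]
      exact inv_anti₀ hδ (h π).le
    calc ‖((ω π : ℂ)⁻¹) • (1 : Matrix (Fin π.dim) (Fin π.dim) ℂ)‖
        ≤ ‖((ω π : ℂ)⁻¹)‖ * ‖(1 : Matrix (Fin π.dim) (Fin π.dim) ℂ)‖ := norm_smul_le _ _
      _ ≤ δ⁻¹ * 1 := mul_le_mul h2 h1 (norm_nonneg _) (inv_nonneg.2 hδ.le)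
      _ = δ⁻¹ := mul_one _⟩

open Classical in
variable (G) in
/-- The predual `VN(G)_* = A(G)`: the normal functionals on `VN(G)`, that is, the bounded
functionals that are completely additive over the blocks `M_{d_π}`. -/
def Predual : Submodule ℂ (StrongDual ℂ (VN G)) where
  carrier := {φ | ∀ A : VN G,
    HasSum (fun π : Dual G => φ (lp.single ∞ π (A π))) (φ A)}
  add_mem' := fun h k A => (h A).add (k A)
  zero_mem' := fun _ => hasSum_zero
  smul_mem' := fun c _ h A => (h A).const_smul c

/-- The norm on `M_m(VN(G)) = ⊕^∞ M_m(M_{d_π})`. -/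
def matNormVN {m : ℕ} (T : Matrix (Fin m) (Fin m) (VN G)) : ℝ :=
  ⨆ π : Dual G,
    ‖(Matrix.of fun a b => T a.1 b.1 π a.2 b.2 :
      Matrix (Fin m × Fin π.dim) (Fin m × Fin π.dim) ℂ)‖

/-- The norm on `M_n(VN(G)_*)`: the completely bounded norm of the map
`VN(G) → M_n, A ↦ [φ_{ij}(A)]`. -/
def matNormPredual {n : ℕ} (Φ : Matrix (Fin n) (Fin n) (Predual G)) : ℝ :=
  sInf {c : ℝ | 0 ≤ c ∧ ∀ (m : ℕ) (T : Matrix (Fin m) (Fin m) (VN G)),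
    ‖(Matrix.of fun a b => (Φ a.2 b.2 : StrongDual ℂ (VN G)) (T a.1 b.1) :
      Matrix (Fin m × Fin n) (Fin m × Fin n) ℂ)‖ ≤ c * matNormVN T}

/-- `f` is the function on `G` given by `W⁻¹φ`, where `(W⁻¹φ)(A) = φ(A W⁻¹)`; that is,
`f(s) = φ(λ(s) W⁻¹)`. -/
def Represents {ω : Dual G → ℝ} (hω : IsCentralWeight ω) (φ : Predual G) (f : C(G, ℂ)) : Prop :=
  ∀ s : G, f s = (φ : StrongDual ℂ (VN G)) (lam s * invWeight hω)

/-- The Beurling-Fourier algebra `A(G, ω) = {W⁻¹φ : φ ∈ VN(G)_*}`, as a space of continuous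
functions on `G`. It is the predual of `VN(G, ω⁻¹) = {AW : A ∈ VN(G)}` for the
bracket `⟨W⁻¹φ, AW⟩ = φ(A)`. -/
def BFAlgebra {ω : Dual G → ℝ} (hω : IsCentralWeight ω) : Submodule ℂ C(G, ℂ) where
  carrier := {f | ∃ φ : Predual G, Represents hω φ f}
  add_mem' := by
    rintro f g ⟨φ, hφ⟩ ⟨ψ, hψ⟩
    exact ⟨φ + ψ, fun s => by simp [hφ s, hψ s]⟩
  zero_mem' := ⟨0, fun s => by simp⟩
  smul_mem' := by
    rintro c f ⟨φ, hφ⟩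
    exact ⟨c • φ, fun s => by simp [hφ s]⟩

/-- The norm on `M_n(A(G, ω))`: since `AW ↦ A` is by definition a complete isometry of
`VN(G, ω⁻¹)` onto `VN(G)`, the norm of `[W⁻¹φ_{ij}]` is the norm of `[φ_{ij}]` in
`M_n(VN(G)_*)`. (For compact `G`, the `φ_{ij}` are determined by the functions, so that the infimum
is over a single matrix.) -/
def matNorm {ω : Dual G → ℝ} (hω : IsCentralWeight ω) {n : ℕ}
    (F : Matrix (Fin n) (Fin n) (BFAlgebra hω)) : ℝ :=
  sInf (matNormPredual '' {Φ : Matrix (Fin n) (Fin n) (Predual G) |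
    ∀ i j, Represents hω (Φ i j) (F i j)})

/-- A linear map `R : A(G, ω) → A(K, ω')` is a complete quotient map: for each `n`, its
amplification maps the open unit ball of `M_n(A(G, ω))` onto that of `M_n(A(K, ω'))`. -/
def IsCompleteQuotientMap {K : Type u} [Group K] [TopologicalSpace K]
    {ω : Dual G → ℝ} {ω' : Dual K → ℝ} {hω : IsCentralWeight ω} {hω' : IsCentralWeight ω'}
    (R : BFAlgebra hω →ₗ[ℂ] BFAlgebra hω') : Prop :=
  ∀ n : ℕ, (fun F : Matrix (Fin n) (Fin n) (BFAlgebra hω) => F.map R) '' {F | matNorm hω F < 1} =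
    {F | matNorm hω' F < 1}

variable (G) in
/-- The trigonometric polynomials `T(G)`: the span of the coefficient functions `π_{ij}`. -/
def trigPoly : Submodule ℂ C(G, ℂ) :=
  Submodule.span ℂ {f | ∃ (π : Dual G) (i j : Fin π.dim), ∀ s, f s = π.rep.mat s i j}

end Algebras

end BeurlingFourier

end

/-! Restriction is the preadjoint of a normal map `N : VN(H) → VN(G)` with `N(λ(h) W_H⁻¹) = λ(h)
W⁻¹`: if `f = W⁻¹φ`, then `f(h) = φ(N(λ(h) W_H⁻¹))`, so `f|_H = W_H⁻¹(φ ∘ N)`. To build `N`,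
decompose `π|_H` into irreducibles `σ_k` with isometric intertwiners `V_k`, and let the component at
`π` be `A ↦ ∑ V_k (ω_H(σ_k)/ω(π)) A(σ_k) V_kᴴ`. Since `π` extends each `σ_k`, the coefficients are
at most 1 and `N` is a complete contraction (`exists_blockMap_inclusion`). Hence open unit balls go
into open unit balls.

For surjectivity, let `t > 1` and choose for each `τ` an extension `π_τ` with `ω(π_τ) < t ω_H(τ)`
and an isometric intertwiner `V_τ`. The map with components `A ↦ (ω(π_τ)/ω_H(τ)) V_τᴴ A(π_τ) V_τ` is
normal, completely bounded by `t`, and carries `λ(h) W⁻¹` to `λ(h) W_H⁻¹`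
(`exists_blockMap_compression`). Composing functionals with it lifts functions from `H` to `G` at
the cost of a factor `t`, which the open ball absorbs. Both maps are instances of `BlockMap`, where
normality and the complete bound are proved once.

All this needs every `τ` to have an extension (`exists_extends`). Otherwise, by Schur averaging, all
coefficients of `G` would be orthogonal on `H` to a diagonal coefficient of `τ`. They are uniformly
dense in `C(G)` by Stone–Weierstrass, and Tietze extension would make that coefficient vanish. The
separation of points (`exists_mat_ne_one`) comes from the spectral theorem for compact operators on
`L²(G)` commuting with left translation.

Submultiplicativity of `ω_H` holds because `σ ⊆ τ ⊗ τ' ⊆ (π ⊗ π')|_H` forces some constituent of `π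
⊗ π'` to extend `σ`. -/

namespace BeurlingFourier

universe u

/-! ### Complete reducibility and Schur's lemma for unitary matrix representations. -/

section Decomposition

variable {G : Type u} [Group G] [TopologicalSpace G]
variable {ι κ μ : Type*} [Fintype ι] [DecidableEq ι] [Fintype κ] [DecidableEq κ]
  [Fintype μ] [DecidableEq μ]

theorem Dual.isIrreducible_rep (π : Dual G) : π.rep.IsIrreducible := π.irrep.irreducible

namespace UnitaryRep

@[simp] theorem mat_one (ρ : UnitaryRep G ι) : ρ.mat 1 = 1 := by simp [mat]

theorem mat_mul (ρ : UnitaryRep G ι) (g h : G) : ρ.mat (g * h) = ρ.mat g * ρ.mat h := by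
  simp [mat]

theorem conjTranspose_mat_mul_mat (ρ : UnitaryRep G ι) (g : G) : (ρ.mat g)ᴴ * ρ.mat g = 1 :=
  Matrix.mem_unitaryGroup_iff'.1 (ρ g).2

theorem conjTranspose_mat (ρ : UnitaryRep G ι) (g : G) : (ρ.mat g)ᴴ = ρ.mat g⁻¹ := by
  have h : ρ.mat g * ρ.mat g⁻¹ = 1 := by rw [← mat_mul, mul_inv_cancel, mat_one]
  calc (ρ.mat g)ᴴ = (ρ.mat g)ᴴ * (ρ.mat g * ρ.mat g⁻¹) := by rw [h, Matrix.mul_one]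
    _ = ρ.mat g⁻¹ := by rw [← Matrix.mul_assoc, conjTranspose_mat_mul_mat, Matrix.one_mul]

theorem continuous_mat (ρ : UnitaryRep G ι) : Continuous ρ.mat :=
  continuous_subtype_val.comp ρ.continuous_toFun

@[simp] theorem mat_restrict (ρ : UnitaryRep G ι) (H : Subgroup G) (h : H) :
    (ρ.restrict H).mat h = ρ.mat h := rfl

@[simp] theorem mat_tensor (ρ : UnitaryRep G ι) (σ : UnitaryRep G κ) (g : G) :
    (ρ.tensor σ).mat g = ρ.mat g ⊗ₖ σ.mat g := rfl

/-- The adjoint of an intertwiner is an intertwiner. -/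
theorem conjTranspose_intertwines {σ : UnitaryRep G κ} {ρ : UnitaryRep G ι} {X : Matrix ι κ ℂ}
    (h : ∀ g, X * σ.mat g = ρ.mat g * X) (g : G) : Xᴴ * ρ.mat g = σ.mat g * Xᴴ := by
  have := congrArg Matrix.conjTranspose (h g⁻¹)
  rw [Matrix.conjTranspose_mul, Matrix.conjTranspose_mul, conjTranspose_mat, conjTranspose_mat,
    inv_inv] at this
  exact this.symm

theorem IsContainedIn.trans {σ : UnitaryRep G κ} {ρ : UnitaryRep G ι} {τ : UnitaryRep G μ}
    (h : σ.IsContainedIn ρ) (k : ρ.IsContainedIn τ) : σ.IsContainedIn τ := by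
  obtain ⟨V, hV, hV'⟩ := h
  obtain ⟨U, hU, hU'⟩ := k
  refine ⟨U * V, ?_, fun g => ?_⟩
  · rw [Matrix.conjTranspose_mul, Matrix.mul_assoc, ← Matrix.mul_assoc Uᴴ, hU, Matrix.one_mul, hV]
  · rw [Matrix.mul_assoc, hV', ← Matrix.mul_assoc, hU', Matrix.mul_assoc]

theorem IsContainedIn.tensor {ν : Type*} [Fintype ν] [DecidableEq ν]
    {σ : UnitaryRep G κ} {ρ : UnitaryRep G ι} {σ' : UnitaryRep G μ} {ρ' : UnitaryRep G ν}
    (h : σ.IsContainedIn ρ) (h' : σ'.IsContainedIn ρ') :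
    (σ.tensor σ').IsContainedIn (ρ.tensor ρ') := by
  obtain ⟨V, hV, hV'⟩ := h
  obtain ⟨U, hU, hU'⟩ := h'
  refine ⟨V ⊗ₖ U, ?_, fun g => ?_⟩
  · rw [Matrix.conjTranspose_kronecker, ← Matrix.mul_kronecker_mul, hV, hU,
      Matrix.one_kronecker_one]
  · rw [mat_tensor, mat_tensor, ← Matrix.mul_kronecker_mul, ← Matrix.mul_kronecker_mul, hV', hU']

/-- The matrix representation on a finite-dimensional invariant subspace, with a given orthonormal
basis, of a strongly continuous unitary representation on an inner product space. -/
noncomputable def ofOrthonormal {E : Type*} [NormedAddCommGroup E] [InnerProductSpace ℂ E]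
    (L : G →* (E →ₗᵢ[ℂ] E)) (hL : ∀ v, Continuous fun g => L g v) {b : κ → E}
    (hb : Orthonormal ℂ b)
    (hbL : ∀ g k, L g (b k) = ∑ i, inner ℂ (b i) (L g (b k)) • b i) : UnitaryRep G κ where
  toFun g := ⟨Matrix.of fun i j => inner ℂ (b i) (L g (b j)), by
    rw [Matrix.mem_unitaryGroup_iff']
    ext i j
    have h : inner ℂ (L g (b i)) (L g (b j)) = (1 : Matrix κ κ ℂ) i j := by
      rw [LinearIsometry.inner_map_map, orthonormal_iff_ite.1 hb, Matrix.one_apply]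
    rw [← h, hbL g i, sum_inner, Matrix.mul_apply]
    refine Finset.sum_congr rfl fun k _ => ?_
    rw [inner_smul_left, Matrix.star_apply]
    rfl⟩
  map_one' := by
    apply Subtype.ext
    ext i j
    simp [orthonormal_iff_ite.1 hb, Matrix.one_apply]
  map_mul' g h := by
    apply Subtype.ext
    ext i j
    change inner ℂ (b i) (L (g * h) (b j)) =
      ∑ k, inner ℂ (b i) (L g (b k)) * inner ℂ (b k) (L h (b j))
    rw [map_mul, show (L g * L h) (b j) = L g (L h (b j)) from rfl, hbL h j, map_sum, inner_sum]
    refine Finset.sum_congr rfl fun k _ => ?_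
    rw [← hbL h j, map_smul, inner_smul_right, mul_comm]
  continuous_toFun := by
    refine Continuous.subtype_mk (continuous_matrix fun i j => ?_) _
    exact continuous_const.inner (hL (b j))

theorem ofOrthonormal_mat {E : Type*} [NormedAddCommGroup E] [InnerProductSpace ℂ E]
    (L : G →* (E →ₗᵢ[ℂ] E)) (hL : ∀ v, Continuous fun g => L g v) {b : κ → E}
    (hb : Orthonormal ℂ b)
    (hbL : ∀ g k, L g (b k) = ∑ i, inner ℂ (b i) (L g (b k)) • b i) (g : G) (i j : κ) :
    (ofOrthonormal L hL hb hbL).mat g i j = inner ℂ (b i) (L g (b j)) := rfl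

omit [DecidableEq κ] in
/-- A basis of an invariant subspace satisfies the hypothesis of `ofOrthonormal`. -/
theorem apply_eq_sum_inner_smul_of_invariant {E : Type*} [NormedAddCommGroup E]
    [InnerProductSpace ℂ E] {V : Submodule ℂ E} (b : OrthonormalBasis κ ℂ V) {f : E → E}
    (hf : ∀ v ∈ V, f v ∈ V) (k : κ) :
    f (b k) = ∑ i, inner ℂ (b i : E) (f (b k)) • (b i : E) := by
  have := congrArg (fun v : V => (v : E)) (b.sum_repr' ⟨f (b k), hf _ (b k).2⟩)
  simpa using this.symm

/-- The unitary operators of a matrix representation. -/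
noncomputable def toIsometry (ρ : UnitaryRep G ι) :
    G →* (EuclideanSpace ℂ ι →ₗᵢ[ℂ] EuclideanSpace ℂ ι) where
  toFun g :=
    { toLinearMap := Matrix.toEuclideanLin (ρ.mat g)
      norm_map' := fun v => by
        rw [← sq_eq_sq₀ (norm_nonneg _) (norm_nonneg _)]
        have h : ∀ w : EuclideanSpace ℂ ι,
            ‖w‖ ^ 2 = RCLike.re (w.ofLp ⬝ᵥ star w.ofLp) := fun w => by
          rw [← EuclideanSpace.inner_eq_star_dotProduct, inner_self_eq_norm_sq]
        rw [h, h, Matrix.ofLp_toLpLin, Matrix.toLin'_apply, Matrix.star_mulVec, dotProduct_comm,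
          ← Matrix.dotProduct_mulVec, Matrix.mulVec_mulVec, conjTranspose_mat_mul_mat,
          Matrix.one_mulVec, dotProduct_comm] }
  map_one' := by
    ext v i
    simp
  map_mul' g h := by
    ext v i
    simp [mat_mul, Matrix.toLpLin_apply]

theorem continuous_toIsometry (ρ : UnitaryRep G ι) (v : EuclideanSpace ℂ ι) :
    Continuous fun g => ρ.toIsometry g v :=
  (PiLp.continuous_toLp 2 _).comp (ρ.continuous_mat.matrix_mulVec continuous_const)

/-- The subrepresentation on an invariant subspace, together with the isometric embedding. -/
theorem exists_subrep (ρ : UnitaryRep G ι) (V : Submodule ℂ (EuclideanSpace ℂ ι))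
    (hV : ∀ g, ∀ v ∈ V, ρ.toIsometry g v ∈ V) :
    ∃ (σ : UnitaryRep G (Fin (Module.finrank ℂ V)))
      (J : Matrix ι (Fin (Module.finrank ℂ V)) ℂ),
      Jᴴ * J = 1 ∧ (∀ g, J * σ.mat g = ρ.mat g * J) ∧
        ∀ x, WithLp.toLp 2 ((J * Jᴴ) *ᵥ x) = V.starProjection (WithLp.toLp 2 x) := by
  classical
  set b := stdOrthonormalBasis ℂ V
  have hb : Orthonormal ℂ (fun k => (b k : EuclideanSpace ℂ ι)) :=
    b.orthonormal.comp_linearIsometry V.subtypeₗᵢ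
  have hbL : ∀ g k, _ := fun g k => apply_eq_sum_inner_smul_of_invariant b (hV g) k
  -- The columns of `J` are the basis vectors of `V`, so `J Jᴴ` is the orthogonal projection onto
  -- `V`.
  refine ⟨ofOrthonormal ρ.toIsometry ρ.continuous_toIsometry hb hbL,
    Matrix.of fun i k => (b k : EuclideanSpace ℂ ι) i, ?_, fun g => ?_, fun x => ?_⟩
  · ext i j
    have := orthonormal_iff_ite.1 hb i j
    rw [EuclideanSpace.inner_eq_star_dotProduct, dotProduct_comm] at this
    rw [Matrix.one_apply, ← this]
    rfl
  · ext i j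
    have := congrArg (fun v : EuclideanSpace ℂ ι => v i) (hbL g j)
    change _ = ρ.toIsometry g (b j) i
    simp only at this
    rw [this, Matrix.mul_apply]
    simp [ofOrthonormal_mat, mul_comm]
  · ext i
    rw [Submodule.starProjection_apply, ← b.sum_repr' (V.orthogonalProjectionOnto _)]
    have h : ∀ k, inner ℂ (b k) (V.orthogonalProjectionOnto (WithLp.toLp 2 x)) =
        inner ℂ (b k : EuclideanSpace ℂ ι) (WithLp.toLp 2 x) := fun k =>
      V.inner_orthogonalProjectionOnto_eq_of_mem_left _ _
    simp only [h]
    rw [← Matrix.mulVec_mulVec]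
    simp [Matrix.mulVec, dotProduct, EuclideanSpace.inner_eq_star_dotProduct]
    refine Finset.sum_congr rfl fun k _ => ?_
    rw [mul_comm]
    congr 1
    exact Finset.sum_congr rfl fun l _ => mul_comm _ _

/-- A decomposition of `ρ` into irreducible representations: isometric intertwiners with
complementary ranges. -/
def HasDecomposition (ρ : UnitaryRep G ι) : Prop :=
  ∃ (K : Type) (_ : Fintype K) (π : K → Dual G) (V : ∀ k, Matrix ι (Fin (π k).dim) ℂ),
    (∀ k, (V k)ᴴ * V k = 1) ∧ (∀ k g, V k * (π k).rep.mat g = ρ.mat g * V k) ∧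
      ∑ k, V k * (V k)ᴴ = 1

/-- Decompositions of two complementary subrepresentations yield one of the representation. -/
theorem HasDecomposition.of_complementary {σ : UnitaryRep G κ} {τ : UnitaryRep G μ}
    {ρ : UnitaryRep G ι} (hσ : σ.HasDecomposition) (hτ : τ.HasDecomposition)
    {J : Matrix ι κ ℂ} {J' : Matrix ι μ ℂ} (hJ : Jᴴ * J = 1) (hJ' : J'ᴴ * J' = 1)
    (hJσ : ∀ g, J * σ.mat g = ρ.mat g * J) (hJτ : ∀ g, J' * τ.mat g = ρ.mat g * J')
    (h : J * Jᴴ + J' * J'ᴴ = 1) : ρ.HasDecomposition := by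
  obtain ⟨K, _, π, V, hV, hVπ, hs⟩ := hσ
  obtain ⟨K', _, π', V', hV', hVπ', hs'⟩ := hτ
  refine ⟨K ⊕ K', inferInstance, Sum.elim π π',
    Sum.rec (fun k => J * V k) (fun k => J' * V' k), ?_, ?_, ?_⟩
  · rintro (k | k)
    · change (J * V k)ᴴ * (J * V k) = 1
      rw [Matrix.conjTranspose_mul, Matrix.mul_assoc, ← Matrix.mul_assoc Jᴴ, hJ, Matrix.one_mul,
        hV]
    · change (J' * V' k)ᴴ * (J' * V' k) = 1
      rw [Matrix.conjTranspose_mul, Matrix.mul_assoc, ← Matrix.mul_assoc J'ᴴ, hJ', Matrix.one_mul,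
        hV']
  · rintro (k | k) g
    · change J * V k * (π k).rep.mat g = ρ.mat g * (J * V k)
      rw [Matrix.mul_assoc, hVπ, ← Matrix.mul_assoc, hJσ, Matrix.mul_assoc]
    · change J' * V' k * (π' k).rep.mat g = ρ.mat g * (J' * V' k)
      rw [Matrix.mul_assoc, hVπ', ← Matrix.mul_assoc, hJτ, Matrix.mul_assoc]
  · rw [Fintype.sum_sum_type, ← h]
    congr 1
    · change ∑ k, (J * V k) * (J * V k)ᴴ = _
      calc _ = J * (∑ k, V k * (V k)ᴴ) * Jᴴ := by
            simp only [Matrix.conjTranspose_mul, Matrix.mul_sum, Matrix.sum_mul, Matrix.mul_assoc]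
        _ = _ := by rw [hs, Matrix.mul_one]
    · change ∑ k, (J' * V' k) * (J' * V' k)ᴴ = _
      calc _ = J' * (∑ k, V' k * (V' k)ᴴ) * J'ᴴ := by
            simp only [Matrix.conjTranspose_mul, Matrix.mul_sum, Matrix.sum_mul, Matrix.mul_assoc]
        _ = _ := by rw [hs', Matrix.mul_one]

theorem hasDecomposition_of_isEmpty [IsEmpty ι] (ρ : UnitaryRep G ι) : ρ.HasDecomposition :=
  ⟨Empty, inferInstance, Empty.elim, fun k => k.elim, fun k => k.elim, fun k => k.elim,
    Subsingleton.elim _ _⟩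

/-- `Dual.rep` is a chosen representative of the class of `ρ`, not `ρ` itself; the single
intertwiner is the unitary equivalence between the two. -/
theorem hasDecomposition_of_isIrreducible {n : ℕ} (ρ : UnitaryRep G (Fin n))
    (hρ : ρ.IsIrreducible) : ρ.HasDecomposition := by
  obtain ⟨U, h1, h2, h3⟩ : (Dual.irrep (Quotient.mk _ ⟨n, ρ, hρ⟩)).rep.IsEquivalent ρ :=
    Quotient.exact (Quotient.out_eq (Quotient.mk (irrepSetoid G) ⟨n, ρ, hρ⟩))
  exact ⟨Unit, inferInstance, fun _ => Quotient.mk _ ⟨n, ρ, hρ⟩, fun _ => U, fun _ => h1,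
    fun _ => h3, (Fintype.sum_unique _).trans h2⟩

-- The projections onto `V` and `Vᗮ` add up to the identity. This turns the output of
-- `exists_subrep` into the hypothesis of `HasDecomposition.of_complementary`.
omit [DecidableEq κ] [DecidableEq μ] in
theorem mul_conjTranspose_add_eq_one (V : Submodule ℂ (EuclideanSpace ℂ ι))
    {J : Matrix ι κ ℂ} {J' : Matrix ι μ ℂ}
    (h : ∀ x, WithLp.toLp 2 ((J * Jᴴ) *ᵥ x) = V.starProjection (WithLp.toLp 2 x))
    (h' : ∀ x, WithLp.toLp 2 ((J' * J'ᴴ) *ᵥ x) = Vᗮ.starProjection (WithLp.toLp 2 x)) :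
    J * Jᴴ + J' * J'ᴴ = 1 := by
  refine Matrix.ext_of_mulVec_single fun i => WithLp.toLp_injective 2 ?_
  rw [Matrix.add_mulVec, WithLp.toLp_add, h, h',
    Submodule.starProjection_add_starProjection_orthogonal, Matrix.one_mulVec]

/-- The orthogonal complement of an invariant subspace is invariant. -/
theorem toIsometry_mem_orthogonal (ρ : UnitaryRep G ι) {V : Submodule ℂ (EuclideanSpace ℂ ι)}
    (hV : ∀ g, ∀ v ∈ V, ρ.toIsometry g v ∈ V) (g : G) {v : EuclideanSpace ℂ ι} (hv : v ∈ Vᗮ) :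
    ρ.toIsometry g v ∈ Vᗮ := by
  rw [Submodule.mem_orthogonal] at hv ⊢
  intro u hu
  have h : ρ.toIsometry g (ρ.toIsometry g⁻¹ u) = u := by
    change (ρ.toIsometry g * ρ.toIsometry g⁻¹) u = u
    rw [← map_mul, mul_inv_cancel, map_one]
    rfl
  rw [← h, LinearIsometry.inner_map_map]
  exact hv _ (hV _ _ hu)

theorem hasDecomposition_fin (n : ℕ) : ∀ ρ : UnitaryRep G (Fin n), ρ.HasDecomposition := by
  induction n using Nat.strong_induction_on with
  | _ n ih =>
    intro ρ
    by_cases hρ : ρ.IsIrreducible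
    · exact ρ.hasDecomposition_of_isIrreducible hρ
    rcases isEmpty_or_nonempty (Fin n) with he | he
    · exact ρ.hasDecomposition_of_isEmpty
    simp only [IsIrreducible, he, true_and, not_forall, not_or] at hρ
    obtain ⟨W, hW, hW0, hW1⟩ := hρ
    -- Invariant subspaces live in `Fin n → ℂ`; orthogonal complements need the Euclidean space.
    set e := WithLp.linearEquiv 2 ℂ (Fin n → ℂ)
    set V : Submodule ℂ (EuclideanSpace ℂ (Fin n)) := W.comap e.toLinearMap with hVdef
    have hV : ∀ g, ∀ v ∈ V, ρ.toIsometry g v ∈ V := fun g v hv => hW g _ hv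
    have hV0 : V ≠ ⊥ := fun h => hW0 <| by
      rw [← Submodule.map_comap_eq_of_surjective e.surjective W]
      change V.map e.toLinearMap = ⊥
      rw [h, Submodule.map_bot]
    have hV1 : V ≠ ⊤ := fun h => hW1 <| by
      rw [← Submodule.map_comap_eq_of_surjective e.surjective W]
      change V.map e.toLinearMap = ⊤
      rw [h, Submodule.map_top, LinearEquiv.range]
    have hadd := Submodule.finrank_add_finrank_orthogonal V
    rw [finrank_euclideanSpace_fin] at hadd
    -- Both `V` and `Vᗮ` are nonzero, so both have dimension less than `n` and the induction
    -- hypothesis applies.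
    have hpos := Submodule.one_le_finrank_iff.2 hV0
    have hpos' := Submodule.one_le_finrank_iff.2
      (fun h : Vᗮ = ⊥ => hV1 (Submodule.orthogonal_eq_bot_iff.1 h))
    obtain ⟨σ, J, hJ, hJσ, hJp⟩ := ρ.exists_subrep V hV
    obtain ⟨σ', J', hJ', hJσ', hJp'⟩ := ρ.exists_subrep Vᗮ
      fun g v hv => ρ.toIsometry_mem_orthogonal hV g hv
    exact (ih _ (by omega) σ).of_complementary (ih _ (by omega) σ') hJ hJ' hJσ hJσ'
      (mul_conjTranspose_add_eq_one V hJp hJp')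

/-- Complete reducibility of finite-dimensional unitary representations. -/
theorem hasDecomposition (ρ : UnitaryRep G ι) : ρ.HasDecomposition := by
  -- The trivial splitting `⊤ ⊕ ⊤ᗮ` only serves to replace the index type `ι` by some `Fin n`.
  obtain ⟨σ, J, hJ, hJσ, hJp⟩ := ρ.exists_subrep ⊤ fun _ _ _ => Submodule.mem_top
  obtain ⟨σ', J', hJ', hJσ', hJp'⟩ := ρ.exists_subrep ⊤ᗮ
      fun g v hv => ρ.toIsometry_mem_orthogonal (fun _ _ _ => Submodule.mem_top) g hv
  exact (hasDecomposition_fin _ σ).of_complementary (hasDecomposition_fin _ σ') hJ hJ' hJσ hJσ'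
      (mul_conjTranspose_add_eq_one ⊤ hJp hJp')

/-- Schur's lemma: a matrix commuting with an irreducible representation is scalar. -/
theorem IsIrreducible.eq_smul_one {σ : UnitaryRep G κ} (hσ : σ.IsIrreducible) {S : Matrix κ κ ℂ}
    (hS : ∀ g, S * σ.mat g = σ.mat g * S) : ∃ c : ℂ, S = c • 1 := by
  have := hσ.1
  obtain ⟨c, hc⟩ := Module.End.exists_eigenvalue (Matrix.toLin' S)
  refine ⟨c, ?_⟩
  have h := (hσ.2 (Module.End.eigenspace (Matrix.toLin' S) c) fun g v hv => by
    rw [Module.End.mem_eigenspace_iff, Matrix.toLin'_apply] at hv ⊢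
    rw [Matrix.mulVec_mulVec, hS, ← Matrix.mulVec_mulVec, hv, Matrix.mulVec_smul]).resolve_left hc
  refine Matrix.ext_of_mulVec_single fun i => ?_
  have : Pi.single i 1 ∈ Module.End.eigenspace (Matrix.toLin' S) c := h ▸ Submodule.mem_top
  rw [Module.End.mem_eigenspace_iff, Matrix.toLin'_apply] at this
  rw [this, Matrix.smul_mulVec, Matrix.one_mulVec]

/-- A nonzero intertwiner from an irreducible representation is a multiple of an isometry. -/
theorem IsIrreducible.isContainedIn {σ : UnitaryRep G κ} (hσ : σ.IsIrreducible)
    {ρ : UnitaryRep G ι} {X : Matrix ι κ ℂ} (hX : X ≠ 0)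
    (h : ∀ g, X * σ.mat g = ρ.mat g * X) : σ.IsContainedIn ρ := by
  obtain ⟨i⟩ := hσ.1
  obtain ⟨c, hc⟩ := hσ.eq_smul_one (S := Xᴴ * X) fun g => by
    rw [Matrix.mul_assoc, h, ← Matrix.mul_assoc, conjTranspose_intertwines h, Matrix.mul_assoc]
  have hc0 : c ≠ 0 := by
    rintro rfl
    apply hX
    rw [zero_smul] at hc
    rw [← norm_eq_zero, ← mul_self_eq_zero, ← Matrix.l2_opNorm_conjTranspose_mul_self, hc,
      norm_zero]
  -- A diagonal entry of `Xᴴ X = c • 1` shows that `c` is a nonnegative real, so that `X / √c` is an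
  -- isometry.
  have hci : c = ((∑ j, ‖X j i‖ ^ 2 : ℝ) : ℂ) := by
    have := congrFun (congrFun hc i) i
    rw [Matrix.mul_apply, Matrix.smul_apply, Matrix.one_apply_eq, smul_eq_mul, mul_one] at this
    rw [← this]
    push_cast
    refine Finset.sum_congr rfl fun j _ => ?_
    rw [Matrix.conjTranspose_apply, ← Complex.conj_mul']
    rfl
  set r : ℝ := ∑ j, ‖X j i‖ ^ 2
  have hr : 0 < r := lt_of_le_of_ne (Finset.sum_nonneg fun j _ => sq_nonneg _) fun h0 =>
    hc0 (by rw [hci, ← h0, Complex.ofReal_zero])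
  have hs : ((√r : ℝ) : ℂ) ≠ 0 := Complex.ofReal_ne_zero.2 (Real.sqrt_pos.2 hr).ne'
  refine ⟨((√r : ℝ) : ℂ)⁻¹ • X, ?_, fun g => ?_⟩
  · rw [Matrix.conjTranspose_smul, Matrix.smul_mul, Matrix.mul_smul, hc, hci, smul_smul, smul_smul,
      star_inv₀, Complex.star_def, Complex.conj_ofReal]
    have hrs : (r : ℂ) = ((√r : ℝ) : ℂ) * ((√r : ℝ) : ℂ) := by
      rw [← Complex.ofReal_mul, Real.mul_self_sqrt hr.le]
    rw [hrs, mul_assoc, inv_mul_cancel_left₀ hs, inv_mul_cancel₀ hs, one_smul]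
  · rw [Matrix.smul_mul, h, Matrix.mul_smul]

/-- An irreducible representation of a subgroup that has a nonzero intertwiner into the restriction
of `ρ` is contained in the restriction of an irreducible constituent of `ρ`. -/
theorem exists_memSupp_extends (ρ : UnitaryRep G ι) {H : Subgroup G} (τ : Dual H)
    {X : Matrix ι (Fin τ.dim) ℂ} (hX : X ≠ 0)
    (h : ∀ g : H, X * τ.rep.mat g = ρ.mat g * X) :
    ∃ π : Dual G, π.MemSupp ρ ∧ π.Extends τ := by
  obtain ⟨K, _, π, V, hV, hVπ, hs⟩ := ρ.hasDecomposition
  obtain ⟨k, hk⟩ : ∃ k, (V k)ᴴ * X ≠ 0 := by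
    by_contra! h0
    apply hX
    calc X = (∑ k, V k * (V k)ᴴ) * X := by rw [hs, Matrix.one_mul]
      _ = ∑ k, V k * ((V k)ᴴ * X) := by simp only [Matrix.sum_mul, Matrix.mul_assoc]
      _ = 0 := Finset.sum_eq_zero fun k _ => by rw [h0, Matrix.mul_zero]
  refine ⟨π k, ⟨V k, hV k, hVπ k⟩, τ.isIrreducible_rep.isContainedIn hk fun g => ?_⟩
  rw [Matrix.mul_assoc, mat_restrict, h, ← Matrix.mul_assoc,
    conjTranspose_intertwines (hVπ k), Matrix.mul_assoc]

theorem IsContainedIn.exists_memSupp_extends {ρ : UnitaryRep G ι} {H : Subgroup G} {τ : Dual H}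
    (h : τ.rep.IsContainedIn (ρ.restrict H)) : ∃ π : Dual G, π.MemSupp ρ ∧ π.Extends τ := by
  obtain ⟨V, hV, hVτ⟩ := h
  refine ρ.exists_memSupp_extends τ (X := V) ?_ hVτ
  rintro rfl
  obtain ⟨i⟩ := τ.isIrreducible_rep.1
  have := congrFun (congrFun hV i) i
  rw [Matrix.mul_zero, Matrix.zero_apply, Matrix.one_apply_eq] at this
  exact zero_ne_one this

end UnitaryRep

end Decomposition

/-! ### Finite-dimensional representations separate the points of a compact group. -/

section PeterWeyl

open MeasureTheory

section Abstract

variable {G : Type u} [Group G] [TopologicalSpace G]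
  {E : Type*} [NormedAddCommGroup E] [InnerProductSpace ℂ E]

/-- If all finite-dimensional unitary representations are trivial at `g`, then so are all
finite-dimensional subrepresentations of unitary representations on inner product spaces. -/
theorem apply_eq_self_of_forall_mat_eq_one (L : G →* (E →ₗᵢ[ℂ] E))
    (hL : ∀ v, Continuous fun g => L g v) (g : G)
    (hg : ∀ (n : ℕ) (ρ : UnitaryRep G (Fin n)), ρ.mat g = 1)
    (V : Submodule ℂ E) [FiniteDimensional ℂ V] (hV : ∀ g, ∀ v ∈ V, L g v ∈ V)
    {v : E} (hv : v ∈ V) : L g v = v := by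
  set b := stdOrthonormalBasis ℂ V
  have hb : Orthonormal ℂ (fun k => (b k : E)) := b.orthonormal.comp_linearIsometry V.subtypeₗᵢ
  have hbL : ∀ g k, _ := fun g k =>
    UnitaryRep.apply_eq_sum_inner_smul_of_invariant b (hV g) k
  have h1 := hg _ (UnitaryRep.ofOrthonormal L hL hb hbL)
  have h2 : ∀ k, L g (b k) = b k := fun k => by
    rw [hbL g k, Finset.sum_eq_single k]
    · have := congrFun (congrFun h1 k) k
      rw [UnitaryRep.ofOrthonormal_mat, Matrix.one_apply_eq] at this
      rw [this, one_smul]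
    · intro i _ hi
      have := congrFun (congrFun h1 i) k
      rw [UnitaryRep.ofOrthonormal_mat, Matrix.one_apply_ne hi] at this
      rw [this, zero_smul]
    · exact fun h => absurd (Finset.mem_univ _) h
  have h3 : ∑ i, inner ℂ (b i) (⟨v, hv⟩ : V) • (b i : E) = v := by
    simpa using congrArg (fun v : V => (v : E)) (b.sum_repr' ⟨v, hv⟩)
  rw [← h3, map_sum]
  exact Finset.sum_congr rfl fun i _ => by rw [map_smul, h2]

variable [CompleteSpace E]

/-- A compact operator that commutes with a unitary representation only sees its
finite-dimensional subrepresentations. -/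
theorem compact_apply_eq_of_forall_mat_eq_one (L : G →* (E →ₗᵢ[ℂ] E))
    (hL : ∀ v, Continuous fun g => L g v) (g : G)
    (hg : ∀ (n : ℕ) (ρ : UnitaryRep G (Fin n)), ρ.mat g = 1)
    {A : E →L[ℂ] E} (hA : IsCompactOperator A) (hAL : ∀ g v, A (L g v) = L g (A v)) (v : E) :
    A (L g v) = A v := by
  have hinv : ∀ g v, L g (L g⁻¹ v) = v := fun g v => by
    change (L g * L g⁻¹) v = v
    rw [← map_mul, mul_inv_cancel, map_one]
    rfl
  -- `T = A* A` is compact and self-adjoint and still commutes with the representation, so the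
  -- spectral theorem applies to it even if `A` is not symmetric.
  set T : E →L[ℂ] E := (ContinuousLinearMap.adjoint A).comp A
  have hTi : ∀ v w, inner ℂ (T v) w = inner ℂ (A v) (A w) := fun v w =>
    ContinuousLinearMap.adjoint_inner_left A w (A v)
  have hT : IsCompactOperator T := hA.clm_comp (ContinuousLinearMap.adjoint A)
  have hTs : T.IsSymmetric := fun v w => by
    change inner ℂ (T v) w = inner ℂ v (T w)
    rw [hTi, ← inner_conj_symm v, hTi, inner_conj_symm]
  have hTL : ∀ g v, T (L g v) = L g (T v) := fun g v => by
    refine ext_inner_right ℂ fun w => ?_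
    rw [hTi, hAL]
    conv_rhs => rw [← hinv g w, LinearIsometry.inner_map_map, hTi]
    conv_lhs => rw [← hinv g w, hAL, LinearIsometry.inner_map_map]
  -- For `c ≠ 0` the eigenspace is a finite-dimensional subrepresentation, on which `g` acts
  -- trivially; for `c = 0` both `T w` and `T (L g w) = L g (T w)` vanish. The eigenspaces span a
  -- dense subspace, so `T ∘ L g = T`.
  have hE : ∀ c, Module.End.eigenspace (T : Module.End ℂ E) c ≤
      LinearMap.ker ((T.comp (L g).toContinuousLinearMap - T : E →L[ℂ] E) : E →ₗ[ℂ] E) := by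
    intro c w hw
    have hinvE : ∀ g, ∀ v ∈ Module.End.eigenspace (T : Module.End ℂ E) c,
        L g v ∈ Module.End.eigenspace (T : Module.End ℂ E) c := by
      intro g v hv
      rw [Module.End.mem_eigenspace_iff] at hv ⊢
      change T (L g v) = c • L g v
      rw [hTL, show T v = c • v from hv, map_smul]
    have : T (L g w) - T w = 0 := by
      by_cases hc : c = 0
      · rw [Module.End.mem_eigenspace_iff, hc, zero_smul] at hw
        rw [hTL, show T w = 0 from hw, map_zero, sub_zero]
      · have := ContinuousLinearMap.finite_dimensional_eigenspace hT c hc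
        rw [apply_eq_self_of_forall_mat_eq_one L hL g hg _ hinvE hw, sub_self]
    exact this
  have htop : LinearMap.ker ((T.comp (L g).toContinuousLinearMap - T : E →L[ℂ] E) : E →ₗ[ℂ] E) =
      ⊤ := by
    have h := Submodule.topologicalClosure_eq_top_iff.2
      (ContinuousLinearMap.orthogonalComplement_iSup_eigenspaces_eq_bot hT hTs)
    rw [eq_top_iff, ← h]
    exact Submodule.topologicalClosure_minimal _ (iSup_le hE)
      (ContinuousLinearMap.isClosed_ker _)
  have h0 : T (L g v - v) = 0 := by
    have : v ∈ LinearMap.ker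
      ((T.comp (L g).toContinuousLinearMap - T : E →L[ℂ] E) : E →ₗ[ℂ] E) := htop ▸ Submodule.mem_top
    rw [map_sub]
    exact this
  -- `‖A u‖² = ⟨T u, u⟩` for `u = L g v - v`.
  have h1 : A (L g v - v) = 0 := by
    rw [← inner_self_eq_zero (𝕜 := ℂ), ← hTi, h0, inner_zero_left]
  rwa [map_sub, sub_eq_zero] at h1

end Abstract

section Translation

variable {G : Type u} [Group G] [TopologicalSpace G] [IsTopologicalGroup G] [CompactSpace G]

/-- The translates `x ↦ (y ↦ k (y⁻¹ x))` of a continuous function. -/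
noncomputable def translates (k : C(G, ℂ)) : C(G, C(G, ℂ)) :=
  ContinuousMap.curry ⟨fun p : G × G => k (p.2⁻¹ * p.1), by fun_prop⟩

variable [MeasurableSpace G] [BorelSpace G] (μ : Measure G) [μ.IsHaarMeasure]

/-- The left regular representation on `L²(G)`. -/
noncomputable def leftTranslation : G →* (Lp ℂ 2 μ →ₗᵢ[ℂ] Lp ℂ 2 μ) where
  toFun g :=
    -- The action of `DomMulAct.mk c` is `f ↦ f(c ·)`; the inverse makes this the left translation
    -- `f(g⁻¹ ·)`.
    { toFun := fun f => DomMulAct.mk g⁻¹ • f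
      map_add' := fun _ _ => smul_add _ _ _
      map_smul' := fun c f => smul_comm _ c f
      norm_map' := fun f => DomMulAct.norm_smul_Lp _ f }
  map_one' := by
    ext1 f
    change DomMulAct.mk (1 : G)⁻¹ • f = f
    rw [inv_one, DomMulAct.mk_one, one_smul]
  map_mul' g h := by
    ext1 f
    change DomMulAct.mk (g * h)⁻¹ • f = DomMulAct.mk g⁻¹ • DomMulAct.mk h⁻¹ • f
    rw [mul_inv_rev, DomMulAct.mk_mul, mul_smul]

theorem continuous_leftTranslation [μ.InnerRegularCompactLTTop] (f : Lp ℂ 2 μ) :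
    Continuous fun g => leftTranslation μ g f := by
  have : Fact ((2 : ℝ≥0∞) ≠ ∞) := ⟨by simp⟩
  have h : Continuous fun g : G => DomMulAct.mk g⁻¹ :=
    DomMulAct.continuous_mk.comp continuous_inv
  exact h.smul continuous_const

theorem leftTranslation_toLp (k : C(G, ℂ)) (g x : G) :
    leftTranslation μ g (ContinuousMap.toLp 2 μ ℂ (translates k x)) =
      ContinuousMap.toLp 2 μ ℂ (translates k (g * x)) := by
  apply Lp.ext
  refine (DomMulAct.smul_Lp_ae_eq _ _).trans ?_
  have h1 := (measurePreserving_mul_left μ g⁻¹).quasiMeasurePreserving.ae_eq_comp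
    (ContinuousMap.coeFn_toLp (p := 2) (𝕜 := ℂ) μ (translates k x))
  refine h1.trans (Filter.EventuallyEq.trans (Filter.Eventually.of_forall fun y => ?_)
    (ContinuousMap.coeFn_toLp (p := 2) (𝕜 := ℂ) μ (translates k (g * x))).symm)
  change k ((g⁻¹ * y)⁻¹ * x) = k (y⁻¹ * (g * x))
  rw [mul_inv_rev, inv_inv, mul_assoc]

/-- The vectors `k(·⁻¹ x)` in `L²(G)`. -/
noncomputable def kernelVectors (k : C(G, ℂ)) : C(G, Lp ℂ 2 μ) :=
  ⟨fun x => ContinuousMap.toLp 2 μ ℂ (translates k x), by fun_prop⟩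

/-- The integral operator `f ↦ (x ↦ ∫ conj k(y⁻¹ x) f(y) dy)` into the continuous functions. -/
noncomputable def kernelOperator (k : C(G, ℂ)) : Lp ℂ 2 μ →L[ℂ] C(G, ℂ) :=
  LinearMap.mkContinuous
    { toFun := fun f => ⟨fun x => inner ℂ (kernelVectors μ k x) f, by fun_prop⟩
      map_add' := fun f g => by
        ext x
        exact inner_add_right (𝕜 := ℂ) (kernelVectors μ k x) f g
      map_smul' := fun c f => by
        ext x
        exact inner_smul_right (𝕜 := ℂ) (kernelVectors μ k x) f c }
    ‖kernelVectors μ k‖ fun f => by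
      refine (ContinuousMap.norm_le _ (by positivity)).2 fun x => ?_
      exact (norm_inner_le_norm _ _).trans
        (mul_le_mul_of_nonneg_right ((kernelVectors μ k).norm_coe_le_norm x) (norm_nonneg _))

theorem kernelOperator_apply (k : C(G, ℂ)) (f : Lp ℂ 2 μ) (x : G) :
    kernelOperator μ k f x = inner ℂ (kernelVectors μ k x) f := rfl

/-- Arzelà–Ascoli: for `‖f‖ ≤ 1` the difference of the values at `x₀` and `x` is at most the
distance between the kernel vectors there, and kernel vectors depend continuously on the point. -/
theorem isCompactOperator_kernelOperator (k : C(G, ℂ)) :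
    IsCompactOperator (kernelOperator μ k) := by
  set e := ContinuousMap.isometryEquivBoundedOfCompact G ℂ
  set S : Set (BoundedContinuousFunction G ℂ) :=
    e '' (kernelOperator μ k '' Metric.closedBall 0 1)
  have hS : IsCompact (closure S) := by
    refine BoundedContinuousFunction.arzela_ascoli
      (Metric.closedBall (0 : ℂ) ‖kernelVectors μ k‖) (isCompact_closedBall _ _) S ?_ ?_
    · rintro _ x ⟨_, ⟨f, hf, rfl⟩, rfl⟩
      rw [mem_closedBall_zero_iff] at hf ⊢
      refine (norm_inner_le_norm (𝕜 := ℂ) (kernelVectors μ k x) f).trans ?_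
      exact (mul_le_of_le_one_right (norm_nonneg _) hf).trans
        ((kernelVectors μ k).norm_coe_le_norm x)
    · intro x₀
      refine Metric.equicontinuousAt_of_continuity_modulus
        (fun x => ‖kernelVectors μ k x₀ - kernelVectors μ k x‖) ?_ _
        (Filter.Eventually.of_forall ?_)
      · have : Continuous fun x => ‖kernelVectors μ k x₀ - kernelVectors μ k x‖ := by fun_prop
        simpa using this.tendsto x₀
      · rintro x ⟨_, _, ⟨f, hf, rfl⟩, rfl⟩
        rw [mem_closedBall_zero_iff] at hf
        change dist (inner ℂ (kernelVectors μ k x₀) f) (inner ℂ (kernelVectors μ k x) f) ≤ _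
        rw [dist_eq_norm, ← inner_sub_left]
        exact (norm_inner_le_norm _ _).trans (mul_le_of_le_one_right (norm_nonneg _) hf)
  refine ⟨e.symm '' closure S, hS.image e.symm.continuous, ?_⟩
  filter_upwards [Metric.closedBall_mem_nhds (0 : Lp ℂ 2 μ) one_pos] with f hf
  exact ⟨_, subset_closure ⟨_, ⟨f, hf, rfl⟩, rfl⟩, e.symm_apply_apply _⟩

/-- Left translation by `g` is isometric and carries the kernel vector at `g⁻¹ x` to the one at `x`.
-/
theorem kernelOperator_leftTranslation (k : C(G, ℂ)) (g : G) (f : Lp ℂ 2 μ) (x : G) :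
    kernelOperator μ k (leftTranslation μ g f) x = kernelOperator μ k f (g⁻¹ * x) := by
  rw [kernelOperator_apply, kernelOperator_apply,
    ← LinearIsometry.inner_map_map (leftTranslation μ g) (kernelVectors μ k (g⁻¹ * x))]
  change _ = inner ℂ (leftTranslation μ g (ContinuousMap.toLp 2 μ ℂ (translates k (g⁻¹ * x)))) _
  rw [leftTranslation_toLp, mul_inv_cancel_left]
  rfl

theorem toLp_kernelOperator_leftTranslation (k : C(G, ℂ)) (g : G) (f : Lp ℂ 2 μ) :
    ContinuousMap.toLp 2 μ ℂ (kernelOperator μ k (leftTranslation μ g f)) =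
      leftTranslation μ g (ContinuousMap.toLp 2 μ ℂ (kernelOperator μ k f)) := by
  apply Lp.ext
  refine Filter.EventuallyEq.trans ?_ (DomMulAct.smul_Lp_ae_eq _ _).symm
  have h1 := (measurePreserving_mul_left μ g⁻¹).quasiMeasurePreserving.ae_eq_comp
    (ContinuousMap.coeFn_toLp (p := 2) (𝕜 := ℂ) μ (kernelOperator μ k f))
  refine Filter.EventuallyEq.trans (ContinuousMap.coeFn_toLp (p := 2) (𝕜 := ℂ) μ _)
    (Filter.EventuallyEq.trans (Filter.Eventually.of_forall fun y => ?_) h1.symm)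
  exact kernelOperator_leftTranslation μ k g f y

end Translation

section Separation

variable {G : Type u} [Group G] [TopologicalSpace G] [IsTopologicalGroup G] [CompactSpace G]
  [T2Space G]

/-- The Gelfand–Raikov theorem for compact groups: finite-dimensional unitary representations
separate the points. -/
theorem exists_mat_ne_one {g : G} (hg : g ≠ 1) :
    ∃ (n : ℕ) (ρ : UnitaryRep G (Fin n)), ρ.mat g ≠ 1 := by
  by_contra! hρ
  borelize G
  set μ : Measure G := Measure.haarMeasure ⊤
  -- The kernel is chosen with `k(g⁻¹) = 0` and `k(1) = 1`, so that its vectors at `g⁻¹` and `1`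
  -- differ.
  obtain ⟨k, hk0, hk1, -⟩ := exists_continuous_zero_one_of_isClosed
    (isClosed_singleton (x := g⁻¹)) (isClosed_singleton (x := (1 : G)))
    (by simpa using hg)
  set k' : C(G, ℂ) := ⟨fun x => (k x : ℂ), by fun_prop⟩
  have hA : IsCompactOperator
      ((ContinuousMap.toLp 2 μ ℂ : C(G, ℂ) →L[ℂ] Lp ℂ 2 μ).comp (kernelOperator μ k')) :=
    (isCompactOperator_kernelOperator μ k').clm_comp (ContinuousMap.toLp 2 μ ℂ)
  have h1 : ∀ f, kernelOperator μ k' (leftTranslation μ g f) = kernelOperator μ k' f := fun f =>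
    ContinuousMap.toLp_injective μ (𝕜 := ℂ) (compact_apply_eq_of_forall_mat_eq_one
      (leftTranslation μ) (continuous_leftTranslation μ) g hρ hA
      (toLp_kernelOperator_leftTranslation μ k') f)
  -- The operator takes equal values on `f` and its translate by `g`. Evaluation at `1` shows that
  -- the kernel vectors at `g⁻¹` and `1` have the same inner product with every `f`.
  have h2 : kernelVectors μ k' (g⁻¹ * 1) = kernelVectors μ k' 1 := by
    refine ext_inner_right ℂ fun f => ?_
    rw [← kernelOperator_apply, ← kernelOperator_apply, ← kernelOperator_leftTranslation, h1]
  have h3 := DFunLike.congr_fun (ContinuousMap.toLp_injective μ (𝕜 := ℂ) h2) 1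
  have h4 : (k ((1 : G)⁻¹ * (g⁻¹ * 1)) : ℂ) = k ((1 : G)⁻¹ * 1) := h3
  rw [inv_one, one_mul, mul_one, one_mul, hk0 rfl, hk1 rfl] at h4
  simp at h4

end Separation

end PeterWeyl

/-! ### The star algebra of trigonometric polynomials. -/

section Coefficients

variable {G : Type u} [Group G] [TopologicalSpace G]
variable {ι κ : Type*} [Fintype ι] [DecidableEq ι] [Fintype κ] [DecidableEq κ]

namespace UnitaryRep

/-- The coefficient function `ρ_{ij}`. -/
noncomputable def coeff (ρ : UnitaryRep G ι) (i j : ι) : C(G, ℂ) :=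
  ⟨fun s => ρ.mat s i j, ρ.continuous_mat.matrix_elem i j⟩

theorem coeff_apply (ρ : UnitaryRep G ι) (i j : ι) (s : G) : ρ.coeff i j s = ρ.mat s i j := rfl

theorem mat_eq_sum_of_decomposition (ρ : UnitaryRep G ι) {K : Type} [Fintype K] {π : K → Dual G}
    {V : ∀ k, Matrix ι (Fin (π k).dim) ℂ} (hV : ∀ k g, V k * (π k).rep.mat g = ρ.mat g * V k)
    (hs : ∑ k, V k * (V k)ᴴ = 1) (g : G) :
    ρ.mat g = ∑ k, V k * (π k).rep.mat g * (V k)ᴴ := by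
  simp only [hV, Matrix.mul_assoc]
  rw [← Matrix.mul_sum, hs, Matrix.mul_one]

/-- By complete reducibility the span of the irreducible coefficients contains those of every
finite-dimensional unitary representation. Tensor products and conjugates therefore give closure
under products and conjugation. -/
theorem coeff_mem_trigPoly (ρ : UnitaryRep G ι) (i j : ι) : ρ.coeff i j ∈ trigPoly G := by
  obtain ⟨K, _, π, V, -, hV, hs⟩ := ρ.hasDecomposition
  have h : ρ.coeff i j =
      ∑ k, ∑ a, ∑ b, (V k i b * (V k)ᴴ a j) • (π k).rep.coeff b a := by
    ext s
    rw [coeff_apply, ρ.mat_eq_sum_of_decomposition hV hs, Matrix.sum_apply]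
    simp only [ContinuousMap.sum_apply, ContinuousMap.smul_apply, coeff_apply, smul_eq_mul,
      Matrix.mul_apply, Finset.sum_mul]
    refine Finset.sum_congr rfl fun k _ => Finset.sum_congr rfl fun a _ =>
      Finset.sum_congr rfl fun b _ => by ring
  rw [h]
  refine Submodule.sum_mem _ fun k _ => Submodule.sum_mem _ fun a _ => Submodule.sum_mem _
    fun b _ => Submodule.smul_mem _ _ (Submodule.subset_span ⟨π k, b, a, fun _ => rfl⟩)

/-- The conjugate representation. -/
noncomputable def conj (ρ : UnitaryRep G ι) : UnitaryRep G ι where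
  toFun g := ⟨(ρ.mat g).map star, by
    rw [Matrix.mem_unitaryGroup_iff']
    have h := congrArg (fun M : Matrix ι ι ℂ => M.map star) (ρ.conjTranspose_mat_mul_mat g)
    ext i j
    have h' := congrFun (congrFun h i) j
    simp only [Matrix.map_apply, Matrix.mul_apply, star_sum, star_mul'] at h'
    rw [Matrix.mul_apply]
    refine h'.trans ?_
    rw [Matrix.one_apply]
    split_ifs <;> simp⟩
  map_one' := by
    apply Subtype.ext
    ext i j
    change star (ρ.mat 1 i j) = (1 : Matrix ι ι ℂ) i j
    rw [mat_one, Matrix.one_apply]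
    split_ifs <;> simp
  map_mul' g h := by
    apply Subtype.ext
    ext i j
    change star (ρ.mat (g * h) i j) = ∑ k, star (ρ.mat g i k) * star (ρ.mat h k j)
    rw [mat_mul, Matrix.mul_apply, star_sum]
    exact Finset.sum_congr rfl fun k _ => star_mul' _ _
  continuous_toFun := by
    refine Continuous.subtype_mk (continuous_matrix fun i j => ?_) _
    exact (ρ.continuous_mat.matrix_elem i j).star

theorem restrict_tensor (ρ : UnitaryRep G ι) (σ : UnitaryRep G κ) (H : Subgroup G) :
    (ρ.tensor σ).restrict H = (ρ.restrict H).tensor (σ.restrict H) := rfl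

theorem star_coeff (ρ : UnitaryRep G ι) (i j : ι) : star (ρ.coeff i j) = ρ.conj.coeff i j := rfl

theorem coeff_mul_coeff (ρ : UnitaryRep G ι) (σ : UnitaryRep G κ) (i j : ι) (k l : κ) :
    ρ.coeff i j * σ.coeff k l = (ρ.tensor σ).coeff (i, k) (j, l) := rfl

end UnitaryRep

variable (G) in
theorem trigPoly_eq_span : trigPoly G =
    Submodule.span ℂ {f | ∃ (π : Dual G) (i j : Fin π.dim), f = π.rep.coeff i j} := by
  simp only [ContinuousMap.ext_iff]
  rfl

theorem mul_mem_trigPoly {f g : C(G, ℂ)} (hf : f ∈ trigPoly G) (hg : g ∈ trigPoly G) :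
    f * g ∈ trigPoly G := by
  rw [trigPoly_eq_span] at hf hg
  induction hf, hg using Submodule.span_induction₂ with
  | mem_mem f g hf hg =>
    obtain ⟨π, i, j, rfl⟩ := hf
    obtain ⟨σ, k, l, rfl⟩ := hg
    rw [UnitaryRep.coeff_mul_coeff]
    exact UnitaryRep.coeff_mem_trigPoly _ _ _
  | zero_left g hg => rw [zero_mul]; exact zero_mem _
  | zero_right f hf => rw [mul_zero]; exact zero_mem _
  | add_left f f' g _ _ _ h h' => rw [add_mul]; exact add_mem h h'
  | add_right f g g' _ _ _ h h' => rw [mul_add]; exact add_mem h h'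
  | smul_left c f g _ _ h => rw [smul_mul_assoc]; exact Submodule.smul_mem _ _ h
  | smul_right c f g _ _ h => rw [mul_smul_comm]; exact Submodule.smul_mem _ _ h

theorem star_mem_trigPoly {f : C(G, ℂ)} (hf : f ∈ trigPoly G) : star f ∈ trigPoly G := by
  rw [trigPoly_eq_span] at hf
  induction hf using Submodule.span_induction with
  | mem f hf =>
    obtain ⟨π, i, j, rfl⟩ := hf
    rw [UnitaryRep.star_coeff]
    exact UnitaryRep.coeff_mem_trigPoly _ _ _
  | zero => rw [star_zero]; exact zero_mem _
  | add f g _ _ h h' => rw [star_add]; exact add_mem h h'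
  | smul c f _ h => rw [star_smul]; exact Submodule.smul_mem _ _ h

variable (G) in
theorem one_mem_trigPoly : (1 : C(G, ℂ)) ∈ trigPoly G := by
  have h : (1 : C(G, ℂ)) = (1 : UnitaryRep G Unit).coeff () () := by
    ext s
    change 1 = (1 : Matrix Unit Unit ℂ) () ()
    rw [Matrix.one_apply_eq]
  rw [h]
  exact UnitaryRep.coeff_mem_trigPoly _ _ _

variable (G) in
/-- The trigonometric polynomials as a star subalgebra of the continuous functions. -/
noncomputable def trigPolyAlgebra : StarSubalgebra ℂ C(G, ℂ) where
  carrier := trigPoly G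
  mul_mem' := mul_mem_trigPoly
  add_mem' := add_mem
  algebraMap_mem' c := by
    rw [Algebra.algebraMap_eq_smul_one]
    exact Submodule.smul_mem _ _ (one_mem_trigPoly G)
  star_mem' := star_mem_trigPoly

end Coefficients

/-! ### Uniform density by Stone–Weierstrass. -/

section Density

variable {G : Type u} [Group G] [TopologicalSpace G] [IsTopologicalGroup G] [CompactSpace G]
  [T2Space G]

variable (G) in
/-- The trigonometric polynomials are uniformly dense in the continuous functions. -/
theorem dense_trigPoly : Dense (trigPoly G : Set C(G, ℂ)) := by
  have h : (trigPolyAlgebra G).topologicalClosure = ⊤ := by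
    refine ContinuousMap.starSubalgebra_topologicalClosure_eq_top_of_separatesPoints _ ?_
    intro x y hxy
    obtain ⟨n, ρ, hρ⟩ := exists_mat_ne_one (g := x⁻¹ * y) fun h => hxy (by
      rw [← mul_one x, ← h, mul_inv_cancel_left])
    have h1 : ρ.mat x ≠ ρ.mat y := fun h => hρ (by
      rw [UnitaryRep.mat_mul, ← h, ← UnitaryRep.mat_mul, inv_mul_cancel, UnitaryRep.mat_one])
    obtain ⟨i, j, hij⟩ : ∃ i j, ρ.mat x i j ≠ ρ.mat y i j := by
      by_contra! h
      exact h1 (Matrix.ext h)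
    exact ⟨_, ⟨ρ.coeff i j, ρ.coeff_mem_trigPoly i j, rfl⟩, hij⟩
  intro f
  have : f ∈ (trigPolyAlgebra G).topologicalClosure := h ▸ StarSubalgebra.mem_top
  exact this

end Density

/-! ### Irreducible representations of closed subgroups have extensions. -/

section Extension

open MeasureTheory

variable {G : Type u} [Group G] [TopologicalSpace G]
variable {ι κ : Type*} [Fintype ι] [DecidableEq ι] [Fintype κ] [DecidableEq κ]

/-- Averaging over a compact group produces intertwiners. -/
theorem UnitaryRep.exists_intertwiner [IsTopologicalGroup G] [CompactSpace G] [MeasurableSpace G]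
    [BorelSpace G] (μ : Measure G) [μ.IsHaarMeasure] (σ : UnitaryRep G κ) (ρ : UnitaryRep G ι)
    (j : ι) (l : κ) (g : G) :
    (Matrix.of fun i k => ∫ h, ρ.mat h i j * σ.mat h⁻¹ l k ∂μ : Matrix ι κ ℂ) * σ.mat g =
      ρ.mat g * (Matrix.of fun i k => ∫ h, ρ.mat h i j * σ.mat h⁻¹ l k ∂μ : Matrix ι κ ℂ) := by
  have hint : ∀ i k, Integrable (fun h => ρ.mat h i j * σ.mat h⁻¹ l k) μ := fun i k =>
    Continuous.integrable_of_hasCompactSupport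
      ((ρ.continuous_mat.matrix_elem i j).mul
        ((σ.continuous_mat.comp continuous_inv).matrix_elem l k))
      (HasCompactSupport.of_compactSpace _)
  -- The matrix is `∫ ρ(h) E_{jl} σ(h)⁻¹ dh` with a matrix unit `E_{jl}`; the substitution `h ↦ gh`
  -- moves `σ(g)` on the right to `ρ(g)` on the left.
  ext i m
  rw [Matrix.mul_apply, Matrix.mul_apply]
  simp only [Matrix.of_apply]
  simp only [← integral_mul_const, ← integral_const_mul]
  rw [← integral_finsetSum _ fun k _ => (hint i k).mul_const _,
    ← integral_finsetSum _ fun k _ => (hint k m).const_mul _,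
    ← integral_mul_left_eq_self _ g]
  congr 1
  ext h
  have h1 : ∑ k, σ.mat (g * h)⁻¹ l k * σ.mat g k m = σ.mat h⁻¹ l m := by
    rw [← Matrix.mul_apply, ← mat_mul, mul_inv_rev, inv_mul_cancel_right]
  have h2 : ρ.mat (g * h) i j = ∑ k, ρ.mat g i k * ρ.mat h k j := by
    rw [mat_mul, Matrix.mul_apply]
  simp only [mul_assoc]
  rw [← Finset.mul_sum, h1, h2, Finset.sum_mul]
  simp only [mul_assoc]

variable [IsTopologicalGroup G] [CompactSpace G] [T2Space G]

/-- Every irreducible representation of a closed subgroup of a compact group is extended by an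
irreducible representation of the group. -/
theorem exists_extends {H : Subgroup G} (hH : IsClosed (H : Set G)) (τ : Dual H) :
    ∃ π : Dual G, π.Extends τ := by
  by_contra! hτ
  have : CompactSpace H := isCompact_iff_compactSpace.1 hH.isCompact
  let _ : MeasurableSpace H := borel H
  have : BorelSpace H := ⟨rfl⟩
  set μ : Measure H := Measure.haarMeasure ⊤
  obtain ⟨l⟩ := τ.isIrreducible_rep.1
  have hcont : Continuous fun h : H => τ.rep.mat h⁻¹ l l :=
    (τ.rep.continuous_mat.comp continuous_inv).matrix_elem l l
  have hint : ∀ f : C(G, ℂ), Integrable (fun h : H => f h * τ.rep.mat h⁻¹ l l) μ := fun f =>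
    Continuous.integrable_of_hasCompactSupport
      ((f.continuous.comp continuous_subtype_val).mul hcont) (HasCompactSupport.of_compactSpace _)
  obtain ⟨C, hC⟩ := isCompact_univ.exists_bound_of_continuousOn hcont.continuousOn
  -- Since `τ(h⁻¹)_{ll}` is the conjugate of `τ(h)_{ll}`, this is the `L²(H)` pairing of `f|_H` with
  -- `τ_{ll}`.
  let Φ : C(G, ℂ) →L[ℂ] ℂ := LinearMap.mkContinuous
    { toFun := fun f => ∫ h : H, f h * τ.rep.mat h⁻¹ l l ∂μ
      map_add' := fun f g => by
        rw [← integral_add (hint f) (hint g)]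
        exact integral_congr_ae (Filter.Eventually.of_forall fun h => add_mul _ _ _)
      map_smul' := fun c f => by
        rw [RingHom.id_apply, smul_eq_mul, ← integral_const_mul]
        exact integral_congr_ae (Filter.Eventually.of_forall fun h => mul_assoc _ _ _) }
    (C * μ.real Set.univ) fun f => by
      refine (norm_integral_le_of_norm_le_const (C := ‖f‖ * C)
        (Filter.Eventually.of_forall fun h => ?_)).trans (le_of_eq (by ring))
      rw [norm_mul]
      exact mul_le_mul (f.norm_coe_le_norm _) (hC h (Set.mem_univ _)) (norm_nonneg _)
        (norm_nonneg _)
  have hΦ : ∀ f, Φ f = ∫ h : H, f h * τ.rep.mat h⁻¹ l l ∂μ := fun _ => rfl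
  have h0 : ∀ f ∈ trigPoly G, Φ f = 0 := by
    intro f hf
    rw [trigPoly_eq_span] at hf
    induction hf using Submodule.span_induction with
    | mem f hf =>
      obtain ⟨π, i, j, rfl⟩ := hf
      -- A nonzero value would be an entry of an intertwiner from `τ` to `π|_H`, so by Schur's lemma
      -- `π` would extend `τ`.
      by_contra hne
      refine hτ π (τ.isIrreducible_rep.isContainedIn (X := Matrix.of fun i k =>
        ∫ h, (π.rep.restrict H).mat h i j * τ.rep.mat h⁻¹ l k ∂μ) (fun h => hne ?_)
        (UnitaryRep.exists_intertwiner μ τ.rep (π.rep.restrict H) j l))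
      exact congrFun (congrFun h i) l
    | zero => exact map_zero _
    | add f g _ _ h h' => rw [map_add, h, h', add_zero]
    | smul c f _ h => rw [map_smul, h, smul_zero]
  have h1 : ∀ f, Φ f = 0 := fun f =>
    congrFun (Continuous.ext_on (dense_trigPoly G) Φ.continuous continuous_const h0) f
  -- By Tietze, `τ_{ll}` extends to a continuous `f` on `G`. Then `Φ f = ∫ |τ_{ll}|²`, which is
  -- positive because `τ_{ll}(1) = 1`.
  obtain ⟨f, hf⟩ := ContinuousMap.exists_restrict_eq hH
    (⟨fun h => star (τ.rep.mat h⁻¹ l l), hcont.star⟩ : C((H : Set G), ℂ))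
  have hf' : ∀ h : H, f h = star (τ.rep.mat h⁻¹ l l) := fun h => DFunLike.congr_fun hf h
  have h2 := h1 f
  rw [hΦ] at h2
  have h3 : ∫ h : H, ‖τ.rep.mat h⁻¹ l l‖ ^ 2 ∂μ = 0 := by
    rw [← Complex.ofReal_inj, ← integral_complex_ofReal, Complex.ofReal_zero, ← h2]
    congr 1
    ext h
    rw [hf', Complex.ofReal_pow, ← Complex.conj_mul']
    rfl
  have h4 := Continuous.integral_pos_of_hasCompactSupport_nonneg_nonzero (μ := μ) (x := 1)
    (hcont.norm.pow 2) (HasCompactSupport.of_compactSpace _) (fun h => sq_nonneg _)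
    (by simp)
  exact h4.ne' h3

end Extension

/-! ### The restricted weight is a central weight. -/

section RestrictWeight

variable {G : Type u} [Group G] [TopologicalSpace G] {H : Subgroup G} {ω : Dual G → ℝ}

theorem restrictWeight_le (hω : IsCentralWeight ω) {π : Dual G} {τ : Dual H} (h : π.Extends τ) :
    restrictWeight ω H τ ≤ ω π := by
  obtain ⟨δ, -, hδ⟩ := hω.bounded_away
  exact csInf_le ⟨δ, by rintro _ ⟨π, -, rfl⟩; exact (hδ π).le⟩ ⟨π, h, rfl⟩

theorem IsCentralWeight.pos (hω : IsCentralWeight ω) (π : Dual G) : 0 < ω π := by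
  obtain ⟨δ, hδ, h⟩ := hω.bounded_away
  exact hδ.trans (h π)

variable [IsTopologicalGroup G] [CompactSpace G] [T2Space G]

theorem exists_extends_lt (hH : IsClosed (H : Set G)) {τ : Dual H} {c : ℝ}
    (hc : restrictWeight ω H τ < c) : ∃ π : Dual G, π.Extends τ ∧ ω π < c := by
  obtain ⟨π, hπ⟩ := exists_extends hH τ
  obtain ⟨_, ⟨π, hπ, rfl⟩, h⟩ := exists_lt_of_csInf_lt (Set.Nonempty.image ω ⟨π, hπ⟩) hc
  exact ⟨π, hπ, h⟩

theorem IsCentralWeight.restrictWeight (hω : IsCentralWeight ω) (hH : IsClosed (H : Set G)) :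
    IsCentralWeight (restrictWeight ω H) where
  bounded_away := by
    obtain ⟨δ, hδ, h⟩ := hω.bounded_away
    -- The infimum of values above `δ` may equal `δ`, while the bound must be strict.
    refine ⟨δ / 2, half_pos hδ, fun τ => (half_lt_self hδ).trans_le ?_⟩
    obtain ⟨π, hπ⟩ := exists_extends hH τ
    exact le_csInf ⟨_, π, hπ, rfl⟩ (by rintro _ ⟨π, -, rfl⟩; exact (h π).le)
  submul σ τ τ' h := by
    have key : ∀ π π' : Dual G, π.Extends τ → π'.Extends τ' →
        BeurlingFourier.restrictWeight ω H σ ≤ ω π * ω π' := by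
      intro π π' hπ hπ'
      have hc : σ.rep.IsContainedIn ((π.rep.tensor π'.rep).restrict H) := by
        rw [UnitaryRep.restrict_tensor]
        exact UnitaryRep.IsContainedIn.trans h (UnitaryRep.IsContainedIn.tensor hπ hπ')
      obtain ⟨ρ, hρ, hρσ⟩ := hc.exists_memSupp_extends
      exact (restrictWeight_le hω hρσ).trans (hω.submul _ _ _ hρ)
    have hnonneg : ∀ τ : Dual H, 0 ≤ BeurlingFourier.restrictWeight ω H τ := fun τ =>
      Real.sInf_nonneg (by rintro _ ⟨π, -, rfl⟩; exact (hω.pos π).le)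
    -- The infima need not be attained, so `π` and `π'` are taken within `t` of them, with `t > 0`
    -- so small that the product stays within `ε`.
    refine le_of_forall_pos_lt_add fun ε hε => ?_
    have hcont : Filter.Tendsto
        (fun t : ℝ => (BeurlingFourier.restrictWeight ω H τ + t) *
          (BeurlingFourier.restrictWeight ω H τ' + t)) (nhdsWithin 0 (Set.Ioi 0))
        (nhds (BeurlingFourier.restrictWeight ω H τ * BeurlingFourier.restrictWeight ω H τ')) := by
      have : Continuous (fun t : ℝ => (BeurlingFourier.restrictWeight ω H τ + t) *
          (BeurlingFourier.restrictWeight ω H τ' + t)) := by fun_prop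
      simpa using (this.tendsto 0).mono_left nhdsWithin_le_nhds
    obtain ⟨t, ht, ht0⟩ := ((hcont.eventually (gt_mem_nhds (lt_add_of_pos_right _ hε))).and
      self_mem_nhdsWithin).exists
    obtain ⟨π, hπ, hπt⟩ := exists_extends_lt (ω := ω) hH (τ := τ) (lt_add_of_pos_right _ ht0)
    obtain ⟨π', hπ', hπt'⟩ := exists_extends_lt (ω := ω) hH (τ := τ') (lt_add_of_pos_right _ ht0)
    exact (key π π' hπ hπ').trans_lt
      ((mul_le_mul hπt.le hπt'.le (hω.pos _).le ((hω.pos _).trans hπt).le).trans_lt ht)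

end RestrictWeight

/-! ### Operator norms of compressions and block matrices. -/

section MatrixNorm

variable {α β γ : Type*} [Fintype α] [DecidableEq α] [Fintype β] [DecidableEq β]

theorem norm_one_matrix_le : ‖(1 : Matrix α α ℂ)‖ ≤ 1 := norm_le_one_of_mem_unitary (one_mem _)

omit [DecidableEq α] [DecidableEq β] in
theorem inner_toLp_mulVec (W : Matrix α β ℂ) (y : α → ℂ) (z : β → ℂ) :
    inner ℂ (WithLp.toLp 2 y) (WithLp.toLp 2 (W *ᵥ z)) =
      inner ℂ (WithLp.toLp 2 (Wᴴ *ᵥ y)) (WithLp.toLp 2 z) := by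
  rw [EuclideanSpace.inner_eq_star_dotProduct, EuclideanSpace.inner_eq_star_dotProduct]
  change (W *ᵥ z) ⬝ᵥ star y = z ⬝ᵥ star (Wᴴ *ᵥ y)
  rw [Matrix.star_mulVec, Matrix.conjTranspose_conjTranspose, dotProduct_comm,
    Matrix.dotProduct_mulVec, dotProduct_comm]

omit [DecidableEq α] in
theorem norm_mulVec_le (A : Matrix α β ℂ) (x : β → ℂ) :
    ‖WithLp.toLp 2 (A *ᵥ x)‖ ≤ ‖A‖ * ‖WithLp.toLp 2 x‖ :=
  Matrix.l2_opNorm_mulVec A (WithLp.toLp 2 x)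

omit [DecidableEq α] in
theorem norm_le_of_forall_mulVec {A : Matrix α β ℂ} {C : ℝ} (hC : 0 ≤ C)
    (h : ∀ x, ‖WithLp.toLp 2 (A *ᵥ x)‖ ≤ C * ‖WithLp.toLp 2 x‖) : ‖A‖ ≤ C := by
  rw [Matrix.l2_opNorm_def]
  exact ContinuousLinearMap.opNorm_le_bound _ hC fun x => h x.ofLp

/-- A compression of a block-diagonal matrix by a coisometry does not increase the norm. -/
theorem norm_sum_mul_mul_conjTranspose_le {K : Type*} [Fintype K] {d : K → Type*}
    [∀ k, Fintype (d k)] [∀ k, DecidableEq (d k)] {W : ∀ k, Matrix α (d k) ℂ}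
    (hW : ∑ k, W k * (W k)ᴴ = 1) {T : ∀ k, Matrix (d k) (d k) ℂ} {C : ℝ} (hC : 0 ≤ C)
    (hT : ∀ k, ‖T k‖ ≤ C) : ‖∑ k, W k * T k * (W k)ᴴ‖ ≤ C := by
  -- The coisometry condition says that `x ↦ ((W k)ᴴ x)_k` is isometric. Cauchy–Schwarz applied to
  -- `‖y‖² = ⟨y, (∑ W k T k (W k)ᴴ) x⟩` then suffices.
  have hsum : ∀ x : α → ℂ,
      ∑ k, ‖WithLp.toLp 2 ((W k)ᴴ *ᵥ x)‖ ^ 2 = ‖WithLp.toLp 2 x‖ ^ 2 := by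
    intro x
    have h : ∀ k, ‖WithLp.toLp 2 ((W k)ᴴ *ᵥ x)‖ ^ 2 =
        RCLike.re (inner ℂ (WithLp.toLp 2 x) (WithLp.toLp 2 ((W k * (W k)ᴴ) *ᵥ x))) := fun k => by
      rw [← inner_self_eq_norm_sq (𝕜 := ℂ), ← inner_toLp_mulVec, Matrix.mulVec_mulVec]
    simp only [h]
    rw [← map_sum, ← inner_sum, ← WithLp.toLp_sum, ← Matrix.sum_mulVec, hW, Matrix.one_mulVec,
      inner_self_eq_norm_sq]
  refine norm_le_of_forall_mulVec hC fun x => ?_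
  set y := (∑ k, W k * T k * (W k)ᴴ) *ᵥ x with hy
  have h1 : ‖WithLp.toLp 2 y‖ ^ 2 ≤ (C * ‖WithLp.toLp 2 x‖) * ‖WithLp.toLp 2 y‖ := by
    have h2 : ‖WithLp.toLp 2 y‖ ^ 2 = ‖inner ℂ (WithLp.toLp 2 y)
        (WithLp.toLp 2 ((∑ k, W k * T k * (W k)ᴴ) *ᵥ x))‖ := by
      rw [← hy, inner_self_eq_norm_sq_to_K, norm_pow, RCLike.norm_ofReal, abs_norm]
    rw [h2, Matrix.sum_mulVec, WithLp.toLp_sum, inner_sum]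
    calc ‖∑ k, inner ℂ (WithLp.toLp 2 y) (WithLp.toLp 2 ((W k * T k * (W k)ᴴ) *ᵥ x))‖
        ≤ ∑ k, C * (‖WithLp.toLp 2 ((W k)ᴴ *ᵥ y)‖ * ‖WithLp.toLp 2 ((W k)ᴴ *ᵥ x)‖) := by
          refine norm_sum_le_of_le _ fun k _ => ?_
          rw [Matrix.mul_assoc, ← Matrix.mulVec_mulVec, inner_toLp_mulVec, ← Matrix.mulVec_mulVec]
          refine (norm_inner_le_norm _ _).trans ?_
          rw [mul_left_comm]
          refine mul_le_mul_of_nonneg_left ?_ (norm_nonneg _)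
          exact (norm_mulVec_le _ _).trans (mul_le_mul_of_nonneg_right (hT k) (norm_nonneg _))
      _ = C * ∑ k, ‖WithLp.toLp 2 ((W k)ᴴ *ᵥ y)‖ * ‖WithLp.toLp 2 ((W k)ᴴ *ᵥ x)‖ := by
          rw [Finset.mul_sum]
      _ ≤ C * (‖WithLp.toLp 2 y‖ * ‖WithLp.toLp 2 x‖) := by
          refine mul_le_mul_of_nonneg_left ?_ hC
          refine (Real.sum_mul_le_sqrt_mul_sqrt _ _ _).trans ?_
          rw [hsum, hsum, Real.sqrt_sq (norm_nonneg _), Real.sqrt_sq (norm_nonneg _)]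
      _ = _ := by ring
  rcases (norm_nonneg (WithLp.toLp 2 y)).eq_or_lt with h0 | h0
  · rw [← h0]
    positivity
  · rw [sq] at h1
    exact le_of_mul_le_mul_right h1 h0

/-- The block matrix with blocks `S a b`. -/
def blocks (S : α → α → Matrix β β ℂ) : Matrix (α × β) (α × β) ℂ :=
  Matrix.of fun p q => S p.1 q.1 p.2 q.2

variable (β) in
/-- The operator `z ↦ y ⊗ z`. -/
def tensorCol (y : α → ℂ) : Matrix (α × β) β ℂ :=
  Matrix.of fun p j => y p.1 * (1 : Matrix β β ℂ) p.2 j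

-- `(y ⊗ ·)ᴴ (y ⊗ ·) = ‖y‖² • 1`; only an inequality holds in general, as `β` may be empty.
omit [DecidableEq α] in
theorem norm_tensorCol_le (y : α → ℂ) : ‖tensorCol β y‖ ≤ ‖WithLp.toLp 2 y‖ := by
  have h : (tensorCol β y)ᴴ * tensorCol β y = ((‖WithLp.toLp 2 y‖ ^ 2 : ℝ) : ℂ) • 1 := by
    have h1 : ((‖WithLp.toLp 2 y‖ ^ 2 : ℝ) : ℂ) = ∑ a, star (y a) * y a := by
      rw [EuclideanSpace.norm_sq_eq]
      push_cast
      exact Finset.sum_congr rfl fun a _ => (Complex.conj_mul' _).symm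
    ext i j
    rw [h1, Matrix.mul_apply, Fintype.sum_prod_type, Matrix.smul_apply, smul_eq_mul,
      Finset.sum_mul]
    refine Finset.sum_congr rfl fun a _ => ?_
    simp only [tensorCol, Matrix.conjTranspose_apply, Matrix.of_apply]
    rw [Finset.sum_eq_single i]
    · rw [Matrix.one_apply_eq, mul_one]
      exact (mul_assoc _ _ _).symm
    · intro b _ hb
      rw [Matrix.one_apply_ne hb]
      simp
    · exact fun h => absurd (Finset.mem_univ _) h
  have h2 : ‖tensorCol β y‖ * ‖tensorCol β y‖ ≤ ‖WithLp.toLp 2 y‖ * ‖WithLp.toLp 2 y‖ := by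
    rw [← Matrix.l2_opNorm_conjTranspose_mul_self, h, ← sq]
    refine (norm_smul_le _ _).trans ?_
    rw [Complex.norm_real, Real.norm_of_nonneg (sq_nonneg _)]
    exact mul_le_of_le_one_right (sq_nonneg _) norm_one_matrix_le
  exact (mul_self_le_mul_self_iff (norm_nonneg _) (norm_nonneg _)).2 h2

theorem norm_tensorCol_single_le (a : α) : ‖tensorCol β (Pi.single a 1)‖ ≤ 1 := by
  refine (norm_tensorCol_le _).trans (le_of_eq ?_)
  simp

omit [DecidableEq α] in
theorem conjTranspose_tensorCol_mul_apply (x : α → ℂ) (M : Matrix (α × β) γ ℂ) (i : β) (j : γ) :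
    ((tensorCol β x)ᴴ * M) i j = ∑ a, star (x a) * M (a, i) j := by
  rw [Matrix.mul_apply, Fintype.sum_prod_type]
  refine Finset.sum_congr rfl fun a _ => ?_
  simp [tensorCol, Matrix.one_apply, apply_ite (starRingEnd ℂ)]

omit [DecidableEq α] in
theorem mul_tensorCol_apply (y : α → ℂ) (M : Matrix γ (α × β) ℂ) (i : γ) (j : β) :
    (M * tensorCol β y) i j = ∑ a, M i (a, j) * y a := by
  rw [Matrix.mul_apply, Fintype.sum_prod_type]
  refine Finset.sum_congr rfl fun a _ => ?_
  simp [tensorCol, Matrix.one_apply]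

omit [Fintype α] [DecidableEq α] in
theorem tensorCol_mul_apply (x : α → ℂ) (M : Matrix β γ ℂ) (p : α × β) (j : γ) :
    (tensorCol β x * M) p j = x p.1 * M p.2 j := by
  simp [Matrix.mul_apply, tensorCol, Matrix.one_apply]

omit [Fintype α] [DecidableEq α] in
theorem mul_conjTranspose_tensorCol_apply (y : α → ℂ) (M : Matrix γ β ℂ) (i : γ) (q : α × β) :
    (M * (tensorCol β y)ᴴ) i q = M i q.2 * star (y q.1) := by
  simp [Matrix.mul_apply, tensorCol, Matrix.one_apply, apply_ite (starRingEnd ℂ)]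

omit [DecidableEq α] in
theorem tensorCol_mul_blocks_mul_tensorCol (S : α → α → Matrix β β ℂ) (x y : α → ℂ) :
    (tensorCol β x)ᴴ * blocks S * tensorCol β y = ∑ a, ∑ b, (star (x a) * y b) • S a b := by
  ext i j
  rw [Matrix.mul_assoc, conjTranspose_tensorCol_mul_apply]
  simp only [Matrix.sum_apply, Matrix.smul_apply, smul_eq_mul]
  refine Finset.sum_congr rfl fun a _ => ?_
  rw [mul_tensorCol_apply, Finset.mul_sum]
  refine Finset.sum_congr rfl fun b _ => ?_
  simp only [blocks, Matrix.of_apply]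
  ring

theorem blocks_eq_sum (S : α → α → Matrix β β ℂ) :
    blocks S = ∑ a, ∑ b, tensorCol β (Pi.single a 1) * S a b *
      (tensorCol β (Pi.single b 1))ᴴ := by
  ext ⟨a, i⟩ ⟨b, j⟩
  simp only [Matrix.sum_apply, mul_conjTranspose_tensorCol_apply, tensorCol_mul_apply, blocks,
    Matrix.of_apply]
  rw [Finset.sum_eq_single a, Finset.sum_eq_single b]
  · simp
  · intro b' _ hb
    simp [hb.symm]
  · simp
  · intro a' _ ha
    simp [ha.symm]
  · simp

/-- A crude bound, used only to see that suprema and infima in the matrix norms are taken over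
bounded or nonempty sets. -/
theorem norm_blocks_le_sum (S : α → α → Matrix β β ℂ) :
    ‖blocks S‖ ≤ ∑ a, ∑ b, ‖S a b‖ := by
  rw [blocks_eq_sum]
  refine norm_sum_le_of_le _ fun a _ => norm_sum_le_of_le _ fun b _ => ?_
  have h1 := norm_tensorCol_single_le (β := β) a
  have h2 := norm_tensorCol_single_le (β := β) b
  rw [← Matrix.l2_opNorm_conjTranspose] at h2
  calc _ ≤ ‖tensorCol β (Pi.single a 1) * S a b‖ * ‖(tensorCol β (Pi.single b 1))ᴴ‖ :=
        Matrix.l2_opNorm_mul _ _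
    _ ≤ (‖tensorCol β (Pi.single a 1)‖ * ‖S a b‖) * 1 :=
        mul_le_mul (Matrix.l2_opNorm_mul _ _) h2 (norm_nonneg _) (by positivity)
    _ ≤ ‖S a b‖ := by
        rw [mul_one]
        exact mul_le_of_le_one_left (norm_nonneg _) h1

/-- The sum is the compression of `blocks S` by `x ⊗ ·` and `y ⊗ ·`. This is what makes a bounded
functional completely bounded with the same bound. -/
theorem norm_sum_smul_le_norm_blocks (S : α → α → Matrix β β ℂ) (x y : α → ℂ) :
    ‖∑ a, ∑ b, (star (x a) * y b) • S a b‖ ≤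
      ‖WithLp.toLp 2 x‖ * ‖blocks S‖ * ‖WithLp.toLp 2 y‖ := by
  rw [← tensorCol_mul_blocks_mul_tensorCol]
  have h1 := norm_tensorCol_le (β := β) x
  rw [← Matrix.l2_opNorm_conjTranspose] at h1
  refine (Matrix.l2_opNorm_mul _ _).trans ?_
  refine mul_le_mul ((Matrix.l2_opNorm_mul _ _).trans ?_) (norm_tensorCol_le y) (norm_nonneg _)
    (by positivity)
  exact mul_le_mul_of_nonneg_right h1 (norm_nonneg _)

omit [Fintype β] [DecidableEq β] in
theorem blocks_sum_mul_mul {K : Type*} [Fintype K] {d : K → Type*}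
    [∀ k, Fintype (d k)] [∀ k, DecidableEq (d k)] (W : ∀ k, Matrix β (d k) ℂ)
    (T : ∀ k, α → α → Matrix (d k) (d k) ℂ) :
    blocks (fun a b => ∑ k, W k * T k a b * (W k)ᴴ) =
      ∑ k, ((1 : Matrix α α ℂ) ⊗ₖ W k) * blocks (T k) * ((1 : Matrix α α ℂ) ⊗ₖ W k)ᴴ := by
  ext ⟨a, i⟩ ⟨b, j⟩
  simp only [blocks, Matrix.of_apply, Matrix.sum_apply]
  refine Finset.sum_congr rfl fun k _ => ?_
  rw [Matrix.conjTranspose_kronecker, Matrix.conjTranspose_one, Matrix.mul_apply, Matrix.mul_apply,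
    Fintype.sum_prod_type, Finset.sum_eq_single b]
  · refine Finset.sum_congr rfl fun l _ => ?_
    rw [Matrix.mul_apply, Matrix.mul_apply, Fintype.sum_prod_type, Finset.sum_eq_single a]
    · simp
    · intro a' _ ha
      simp [Matrix.one_apply_ne ha.symm]
    · simp
  · intro b' _ hb
    simp [Matrix.one_apply_ne hb]
  · simp

/-- Amplification replaces `W k` by `1 ⊗ W k`, which satisfies the same coisometry condition; hence
the norm bound for compressions is automatically a complete one. -/
theorem norm_blocks_sum_le {K : Type*} [Fintype K] {d : K → Type*}
    [∀ k, Fintype (d k)] [∀ k, DecidableEq (d k)] {W : ∀ k, Matrix β (d k) ℂ}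
    (hW : ∑ k, W k * (W k)ᴴ = 1) {T : ∀ k, α → α → Matrix (d k) (d k) ℂ} {C : ℝ} (hC : 0 ≤ C)
    (hT : ∀ k, ‖blocks (T k)‖ ≤ C) :
    ‖blocks (fun a b => ∑ k, W k * T k a b * (W k)ᴴ)‖ ≤ C := by
  rw [blocks_sum_mul_mul]
  refine norm_sum_mul_mul_conjTranspose_le ?_ hC hT
  simp only [Matrix.conjTranspose_kronecker, Matrix.conjTranspose_one, ← Matrix.mul_kronecker_mul,
    Matrix.mul_one]
  have h : ∑ k, (1 : Matrix α α ℂ) ⊗ₖ (W k * (W k)ᴴ) = 1 ⊗ₖ ∑ k, W k * (W k)ᴴ := by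
    ext p q
    simp [Matrix.sum_apply, Finset.mul_sum]
  rw [h, hW, Matrix.one_kronecker_one]

end MatrixNorm

/-! ### Normal functionals and the functions they represent. -/

section Predual

variable {G : Type u} [Group G] [TopologicalSpace G]

theorem norm_apply_le_norm (A : VN G) (π : Dual G) : ‖A π‖ ≤ ‖A‖ :=
  lp.norm_apply_le_norm (by simp) A π

/-- Needed because the real supremum in `matNormVN` would default to 0 on an unbounded family. -/
theorem bddAbove_norm_blocks {m : ℕ} (T : Matrix (Fin m) (Fin m) (VN G)) :
    BddAbove (Set.range fun π : Dual G => ‖blocks fun a b => T a b π‖) := by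
  refine ⟨∑ a, ∑ b, ‖T a b‖, ?_⟩
  rintro _ ⟨π, rfl⟩
  exact (norm_blocks_le_sum _).trans
    (Finset.sum_le_sum fun a _ => Finset.sum_le_sum fun b _ => norm_apply_le_norm _ _)

theorem norm_blocks_le_matNormVN {m : ℕ} (T : Matrix (Fin m) (Fin m) (VN G)) (π : Dual G) :
    ‖blocks fun a b => T a b π‖ ≤ matNormVN T :=
  le_ciSup (bddAbove_norm_blocks T) π

theorem matNormVN_nonneg {m : ℕ} (T : Matrix (Fin m) (Fin m) (VN G)) : 0 ≤ matNormVN T :=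
  Real.iSup_nonneg fun _ => norm_nonneg _

theorem matNormVN_le {m : ℕ} {T : Matrix (Fin m) (Fin m) (VN G)} {C : ℝ} (hC : 0 ≤ C)
    (h : ∀ π, ‖blocks fun a b => T a b π‖ ≤ C) : matNormVN T ≤ C :=
  Real.iSup_le h hC

/-- Bounded functionals on `VN(G)` are completely bounded. -/
theorem norm_apply_matrix_le (φ : StrongDual ℂ (VN G)) {m : ℕ}
    (T : Matrix (Fin m) (Fin m) (VN G)) :
    ‖(Matrix.of fun a b => φ (T a b) : Matrix (Fin m) (Fin m) ℂ)‖ ≤ ‖φ‖ * matNormVN T := by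
  have h0 := matNormVN_nonneg T
  refine norm_le_of_forall_mulVec (by positivity) fun y => ?_
  set x := (Matrix.of fun a b => φ (T a b) : Matrix (Fin m) (Fin m) ℂ) *ᵥ y with hx
  -- With `x = [φ(T_{ab})] y` this `S` satisfies `φ(S) = ‖x‖²`, while `‖S‖ ≤ ‖x‖ ‖T‖ ‖y‖`.
  set S : VN G := ∑ a, ∑ b, (star (x a) * y b) • T a b with hS
  have h1 : ‖S‖ ≤ ‖WithLp.toLp 2 x‖ * matNormVN T * ‖WithLp.toLp 2 y‖ := by
    refine lp.norm_le_of_forall_le (by positivity) fun π => ?_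
    have h2 : S π = ∑ a, ∑ b, (star (x a) * y b) • T a b π := by
      simp only [hS, lp.coeFn_sum, Finset.sum_apply, lp.coeFn_smul, Pi.smul_apply]
    rw [h2]
    refine (norm_sum_smul_le_norm_blocks (fun a b => T a b π) x y).trans ?_
    gcongr
    exact norm_blocks_le_matNormVN T π
  have h2 : φ S = ((‖WithLp.toLp 2 x‖ ^ 2 : ℝ) : ℂ) := by
    rw [EuclideanSpace.norm_sq_eq]
    push_cast
    rw [hS, map_sum]
    refine Finset.sum_congr rfl fun a _ => ?_
    rw [map_sum, ← Complex.conj_mul']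
    change _ = star (x a) * x a
    rw [show x a = ∑ b, φ (T a b) * y b from rfl, Finset.mul_sum]
    refine Finset.sum_congr rfl fun b _ => ?_
    rw [map_smul, smul_eq_mul]
    ring
  have h3 : ‖WithLp.toLp 2 x‖ * ‖WithLp.toLp 2 x‖ ≤
      (‖φ‖ * matNormVN T * ‖WithLp.toLp 2 y‖) * ‖WithLp.toLp 2 x‖ := by
    calc ‖WithLp.toLp 2 x‖ * ‖WithLp.toLp 2 x‖ = ‖φ S‖ := by
          rw [h2, Complex.norm_real, Real.norm_of_nonneg (sq_nonneg _), sq]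
      _ ≤ ‖φ‖ * (‖WithLp.toLp 2 x‖ * matNormVN T * ‖WithLp.toLp 2 y‖) :=
          (φ.le_opNorm S).trans (mul_le_mul_of_nonneg_left h1 (norm_nonneg _))
      _ = _ := by ring
  rcases (norm_nonneg (WithLp.toLp 2 x)).eq_or_lt with h | h
  · rw [← h]
    positivity
  · exact le_of_mul_le_mul_right h3 h

/-- The completely bounded norm bounds of the map `A ↦ [φ_{ij}(A)]`. -/
def cbBounds {n : ℕ} (Φ : Matrix (Fin n) (Fin n) (Predual G)) : Set ℝ :=
  {c : ℝ | 0 ≤ c ∧ ∀ (m : ℕ) (T : Matrix (Fin m) (Fin m) (VN G)),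
    ‖(Matrix.of fun a b => (Φ a.2 b.2 : StrongDual ℂ (VN G)) (T a.1 b.1) :
      Matrix (Fin m × Fin n) (Fin m × Fin n) ℂ)‖ ≤ c * matNormVN T}

/-- Entrywise complete boundedness gives the bound `∑ ‖φ_{ij}‖`; without any bound the infimum in
`matNormPredual` would default to 0. The swap `e` reorders the index pairs and preserves the norm.
-/
theorem cbBounds_nonempty {n : ℕ} (Φ : Matrix (Fin n) (Fin n) (Predual G)) :
    (cbBounds Φ).Nonempty := by
  refine ⟨∑ i, ∑ j, ‖(Φ i j : StrongDual ℂ (VN G))‖, by positivity, fun m T => ?_⟩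
  set e := Equiv.prodComm (Fin m) (Fin n)
  have h1 : (Matrix.of fun a b => (Φ a.2 b.2 : StrongDual ℂ (VN G)) (T a.1 b.1) :
      Matrix (Fin m × Fin n) (Fin m × Fin n) ℂ) =
      (blocks fun i j => Matrix.of fun a b =>
        (Φ i j : StrongDual ℂ (VN G)) (T a b)).submatrix e e := rfl
  rw [h1, Finset.sum_mul]
  simp only [Finset.sum_mul]
  have h2 : ∀ M : Matrix (Fin n × Fin m) (Fin n × Fin m) ℂ, ‖M.submatrix e e‖ ≤ ‖M‖ := by
    intro M
    refine norm_le_of_forall_mulVec (norm_nonneg _) fun x => ?_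
    have h3 : ∀ {α β : Type} [Fintype α] [Fintype β] (e : α ≃ β) (v : β → ℂ),
        ‖WithLp.toLp 2 (v ∘ e)‖ = ‖WithLp.toLp 2 v‖ := fun e v => by
      rw [EuclideanSpace.norm_eq, EuclideanSpace.norm_eq]
      congr 1
      exact Equiv.sum_comp e fun i => ‖v i‖ ^ 2
    rw [Matrix.submatrix_mulVec_equiv, h3, ← h3 e.symm x]
    exact norm_mulVec_le _ _
  exact (h2 _).trans ((norm_blocks_le_sum _).trans
    (Finset.sum_le_sum fun i _ => Finset.sum_le_sum fun j _ => norm_apply_matrix_le _ T))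

theorem matNormPredual_nonneg {n : ℕ} (Φ : Matrix (Fin n) (Fin n) (Predual G)) :
    0 ≤ matNormPredual Φ :=
  Real.sInf_nonneg fun _ h => h.1

theorem matNormPredual_le {n : ℕ} {Φ : Matrix (Fin n) (Fin n) (Predual G)} {c : ℝ}
    (h : c ∈ cbBounds Φ) : matNormPredual Φ ≤ c :=
  csInf_le ⟨0, fun _ h => h.1⟩ h

open Classical in
/-- Normal functionals are approximated, uniformly on the unit ball, by their restrictions to
finitely many blocks. -/
theorem exists_finset_norm_sub_sum_single_le (φ : Predual G) {ε : ℝ} (hε : 0 < ε) :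
    ∃ F : Finset (Dual G), ∀ A : VN G,
      ‖(φ : StrongDual ℂ (VN G)) A -
        ∑ π ∈ F, (φ : StrongDual ℂ (VN G)) (lp.single ∞ π (A π))‖ ≤ ε * ‖A‖ := by
  set ψ : ∀ π : Dual G, Matrix (Fin π.dim) (Fin π.dim) ℂ →L[ℂ] ℂ := fun π =>
    LinearMap.mkContinuous
      { toFun := fun M => (φ : StrongDual ℂ (VN G)) (lp.single ∞ π M)
        map_add' := fun M N => by rw [lp.single_add, map_add]
        map_smul' := fun c M => by rw [lp.single_smul, map_smul]; rfl }
      ‖(φ : StrongDual ℂ (VN G))‖ fun M => by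
        refine ((φ : StrongDual ℂ (VN G)).le_opNorm _).trans (le_of_eq ?_)
        rw [lp.norm_single (by simp)]
  have hψ : ∀ π M, ψ π M = (φ : StrongDual ℂ (VN G)) (lp.single ∞ π M) := fun _ _ => rfl
  -- Take in each block an element of the unit ball that nearly norms `ψ π`. Normality applied to
  -- the single bounded family of these elements yields `∑ ‖ψ π‖ < ∞`, and the tail of this series
  -- is the uniform error.
  have hex : ∀ π, ∃ M : Matrix (Fin π.dim) (Fin π.dim) ℂ, ‖M‖ ≤ 1 ∧ ‖ψ π‖ / 2 ≤ ‖ψ π M‖ := by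
    intro π
    rcases (norm_nonneg (ψ π)).eq_or_lt with h | h
    · exact ⟨0, by simp, by rw [← h]; simp⟩
    · obtain ⟨M, hM, hM'⟩ := (ψ π).exists_lt_apply_of_lt_opNorm (half_lt_self h)
      exact ⟨M, hM.le, hM'.le⟩
  choose M hM hM' using hex
  have hs : Summable fun π => ‖ψ π‖ := by
    have h1 : Summable fun π => ‖ψ π (M π)‖ :=
      (φ.2 ⟨M, memℓp_infty ⟨1, by rintro _ ⟨π, rfl⟩; exact hM π⟩⟩).summable.norm
    refine Summable.of_nonneg_of_le (fun _ => norm_nonneg _) (fun π => ?_) (h1.mul_left 2)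
    linarith [hM' π]
  obtain ⟨F, hF⟩ := summable_iff_vanishing_norm.1 hs ε hε
  refine ⟨F, fun A => ?_⟩
  have hlim := (((φ.2 A).sub_const
    (∑ π ∈ F, (φ : StrongDual ℂ (VN G)) (lp.single ∞ π (A π)))).norm)
  refine le_of_tendsto hlim (Filter.eventually_atTop.2 ⟨F, fun F' hF' => ?_⟩)
  rw [← Finset.sum_sdiff hF', add_sub_cancel_right]
  calc ‖∑ π ∈ F' \ F, (φ : StrongDual ℂ (VN G)) (lp.single ∞ π (A π))‖
      ≤ ∑ π ∈ F' \ F, ‖ψ π‖ * ‖A‖ := norm_sum_le_of_le _ fun π _ =>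
        ((ψ π).le_opNorm (A π)).trans
          (mul_le_mul_of_nonneg_left (norm_apply_le_norm A π) (norm_nonneg _))
    _ = (∑ π ∈ F' \ F, ‖ψ π‖) * ‖A‖ := by rw [Finset.sum_mul]
    _ ≤ ε * ‖A‖ := by
        refine mul_le_mul_of_nonneg_right ?_ (norm_nonneg _)
        exact (Real.le_norm_self _).trans (hF _ Finset.sdiff_disjoint).le

theorem norm_lam_le (s : G) : ‖lam s‖ ≤ 1 :=
  lp.norm_le_of_forall_le zero_le_one fun π => norm_le_one_of_mem_unitary (π.rep s).2

variable {ω : Dual G → ℝ}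

theorem lam_mul_invWeight_apply (hω : IsCentralWeight ω) (s : G) (π : Dual G) :
    (lam s * invWeight hω) π = ((ω π : ℂ)⁻¹) • π.rep.mat s := by
  rw [lp.infty_coeFn_mul]
  change π.rep.mat s * (((ω π : ℂ)⁻¹) • (1 : Matrix (Fin π.dim) (Fin π.dim) ℂ)) = _
  rw [Matrix.mul_smul, Matrix.mul_one]

/-- The function `W⁻¹φ` is continuous. -/
theorem continuous_apply_lam_mul_invWeight (hω : IsCentralWeight ω) (φ : Predual G) :
    Continuous fun s => (φ : StrongDual ℂ (VN G)) (lam s * invWeight hω) := by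
  classical
  -- `s ↦ λ(s)` need not be norm continuous, but each block is, and `φ` is uniformly close to its
  -- part on finitely many blocks.
  refine continuous_of_uniform_approx_of_continuous fun U hU => ?_
  obtain ⟨ε, hε, hU⟩ := Metric.mem_uniformity_dist.1 hU
  have hC : 0 < ‖invWeight hω‖ + 1 := by positivity
  obtain ⟨F, hF⟩ := exists_finset_norm_sub_sum_single_le φ (div_pos hε hC)
  refine ⟨fun s => ∑ π ∈ F, (φ : StrongDual ℂ (VN G))
    (lp.single ∞ π ((lam s * invWeight hω : VN G) π)), ?_, fun s => hU ?_⟩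
  · refine continuous_finsetSum _ fun π _ => (φ : StrongDual ℂ (VN G)).continuous.comp ?_
    have h1 : Continuous fun s => (lam s * invWeight hω : VN G) π := by
      simp only [lam_mul_invWeight_apply]
      exact π.rep.continuous_mat.const_smul ((ω π : ℂ)⁻¹)
    have h2 : Isometry fun M : Matrix (Fin π.dim) (Fin π.dim) ℂ => (lp.single ∞ π M : VN G) :=
      Isometry.of_dist_eq fun M N => by
        rw [dist_eq_norm, dist_eq_norm, ← lp.single_sub, lp.norm_single ENNReal.zero_lt_top]
    exact h2.continuous.comp h1
  · rw [dist_eq_norm]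
    refine (hF _).trans_lt ?_
    rw [div_mul_eq_mul_div, div_lt_iff₀ hC]
    refine mul_lt_mul_of_pos_left ?_ hε
    refine (norm_mul_le _ _).trans_lt ?_
    nlinarith [norm_lam_le s, norm_nonneg (invWeight hω)]

/-- The coefficient functional `A ↦ A(π)_{ij}`. -/
theorem exists_predual_apply_eq (π : Dual G) (i j : Fin π.dim) :
    ∃ φ : Predual G, ∀ A, (φ : StrongDual ℂ (VN G)) A = A π i j := by
  classical
  have hentry : ∀ A : VN G, ‖A π i j‖ ≤ 1 * ‖A‖ := fun A => by
    have h := norm_mulVec_le (A π) (Pi.single j 1 : Fin π.dim → ℂ)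
    have h1 : ‖WithLp.toLp 2 (Pi.single j 1 : Fin π.dim → ℂ)‖ = 1 := by simp
    rw [h1, mul_one] at h
    refine le_trans ?_ (h.trans ((norm_apply_le_norm A π).trans (one_mul _).ge))
    have h2 := PiLp.norm_apply_le (WithLp.toLp 2 (A π *ᵥ (Pi.single j 1 : Fin π.dim → ℂ))) i
    rw [Matrix.mulVec_single_one] at h2 ⊢
    exact h2
  refine ⟨⟨LinearMap.mkContinuous
    { toFun := fun A => A π i j
      map_add' := fun A B => rfl
      map_smul' := fun c A => rfl } 1 hentry, fun A => ?_⟩, fun A => rfl⟩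
  have h := hasSum_single (f := fun σ : Dual G => (lp.single ∞ σ (A σ) : VN G) π i j) π
    fun σ hσ => by
      rw [lp.single_apply_ne _ _ _ hσ.symm]
      rfl
  rw [lp.single_apply_self] at h
  exact h

theorem trigPoly_le_BFAlgebra (hω : IsCentralWeight ω) : trigPoly G ≤ BFAlgebra hω := by
  refine Submodule.span_le.2 ?_
  rintro f ⟨π, i, j, hf⟩
  obtain ⟨φ, hφ⟩ := exists_predual_apply_eq π i j
  -- The factor `ω π` cancels the block of `W⁻¹` at `π`.
  refine ⟨(ω π : ℂ) • φ, fun s => ?_⟩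
  have h0 : (ω π : ℂ) ≠ 0 := Complex.ofReal_ne_zero.2 (hω.pos π).ne'
  change f s = (ω π : ℂ) * (φ : StrongDual ℂ (VN G)) (lam s * invWeight hω)
  rw [hφ, lam_mul_invWeight_apply, hf]
  change _ = (ω π : ℂ) * ((ω π : ℂ)⁻¹ * π.rep.mat s i j)
  rw [mul_inv_cancel_left₀ h0]

end Predual

/-! ### Normal completely bounded maps given by weighted compressions. -/

section BlockMap

variable (G K : Type u) [Group G] [TopologicalSpace G] [Group K] [TopologicalSpace K]

/-- The data of a normal map `VN(G) → VN(K)` each of whose components is a compression by a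
coisometry of a block-diagonal matrix with weighted blocks. -/
structure BlockMap where
  index : Dual K → Type
  fintype : ∀ π, Fintype (index π)
  source : ∀ π, index π → Dual G
  coef : ∀ π, index π → ℝ
  emb : ∀ π k, Matrix (Fin π.dim) (Fin (source π k).dim) ℂ
  sum_emb : ∀ π, ∑ k, emb π k * (emb π k)ᴴ = 1
  bound : ℝ
  coef_nonneg : ∀ π k, 0 ≤ coef π k
  coef_le : ∀ π k, coef π k ≤ bound
  bound_pos : 0 < bound

namespace BlockMap

attribute [instance] BlockMap.fintype

variable {G K} (B : BlockMap G K)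

/-- The component of the map at `π`. -/
noncomputable def component (A : VN G) (π : Dual K) : Matrix (Fin π.dim) (Fin π.dim) ℂ :=
  ∑ k, B.emb π k * ((B.coef π k : ℂ) • A (B.source π k)) * (B.emb π k)ᴴ

theorem norm_coef_smul_le {E : Type*} [SeminormedAddCommGroup E] [NormedSpace ℂ E] (π : Dual K)
    (k : B.index π) {x : E} {C : ℝ} (hx : ‖x‖ ≤ C) : ‖(B.coef π k : ℂ) • x‖ ≤ B.bound * C := by
  rw [norm_smul, Complex.norm_real, Real.norm_of_nonneg (B.coef_nonneg π k)]
  exact mul_le_mul (B.coef_le π k) hx (norm_nonneg _) B.bound_pos.le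

theorem norm_component_le (A : VN G) (π : Dual K) : ‖B.component A π‖ ≤ B.bound * ‖A‖ :=
  norm_sum_mul_mul_conjTranspose_le (B.sum_emb π) (mul_nonneg B.bound_pos.le (norm_nonneg _))
    fun k => B.norm_coef_smul_le π k (norm_apply_le_norm A _)

theorem component_congr {A A' : VN G} {π : Dual K}
    (h : ∀ k, A (B.source π k) = A' (B.source π k)) : B.component A π = B.component A' π := by
  simp only [component, h]

/-- The map `VN(G) → VN(K)`. -/
noncomputable def toCLM : VN G →L[ℂ] VN K :=
  LinearMap.mkContinuous
    { toFun := fun A => ⟨B.component A, memℓp_infty ⟨B.bound * ‖A‖, by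
        rintro _ ⟨π, rfl⟩
        exact B.norm_component_le A π⟩⟩
      map_add' := fun A A' => by
        apply lp.ext
        funext π
        change B.component (A + A') π = B.component A π + B.component A' π
        simp only [component, lp.coeFn_add, Pi.add_apply, smul_add, Matrix.mul_add,
          Matrix.add_mul, Finset.sum_add_distrib]
      map_smul' := fun c A => by
        apply lp.ext
        funext π
        change B.component (c • A) π = c • B.component A π
        simp only [component, lp.coeFn_smul, Pi.smul_apply, smul_comm _ c, Matrix.mul_smul,
          Matrix.smul_mul, Finset.smul_sum] }
    B.bound fun A => lp.norm_le_of_forall_le (mul_nonneg B.bound_pos.le (norm_nonneg _))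
      (B.norm_component_le A)

theorem toCLM_apply (A : VN G) (π : Dual K) : B.toCLM A π = B.component A π := rfl

theorem norm_toCLM_apply_le (A : VN G) : ‖B.toCLM A‖ ≤ B.bound * ‖A‖ :=
  lp.norm_le_of_forall_le (mul_nonneg B.bound_pos.le (norm_nonneg _)) (B.norm_component_le A)

theorem matNormVN_map_le {m : ℕ} (T : Matrix (Fin m) (Fin m) (VN G)) :
    matNormVN (T.map B.toCLM) ≤ B.bound * matNormVN T := by
  have hC := mul_nonneg B.bound_pos.le (matNormVN_nonneg T)
  refine matNormVN_le hC fun π => ?_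
  refine norm_blocks_sum_le (B.sum_emb π)
    (T := fun k a b => (B.coef π k : ℂ) • T a b (B.source π k)) hC fun k => ?_
  exact B.norm_coef_smul_le π k (norm_blocks_le_matNormVN T (B.source π k))

open Classical in
/-- The map is normal. -/
theorem comp_toCLM_mem_predual (φ : Predual K) :
    (φ : StrongDual ℂ (VN K)).comp B.toCLM ∈ Predual G := by
  intro A
  refine Metric.tendsto_atTop.2 fun ε hε => ?_
  have hC : 0 < B.bound * (‖A‖ + 1) := mul_pos B.bound_pos (by positivity)
  obtain ⟨F, hF⟩ := exists_finset_norm_sub_sum_single_le φ (div_pos hε hC)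
  -- The components at `π ∈ F` depend on finitely many source blocks. Once `S` contains these, the
  -- image of the tail vanishes on `F`, where `φ` is concentrated up to `ε`.
  refine ⟨F.biUnion fun π => Finset.univ.image (B.source π), fun S hS => ?_⟩
  set A' : VN G := A - ∑ τ ∈ S, lp.single ∞ τ (A τ) with hA'
  have happ : ∀ τ, A' τ = if τ ∈ S then 0 else A τ := by
    intro τ
    have h1 : (∑ σ ∈ S, lp.single ∞ σ (A σ) : VN G) τ = if τ ∈ S then A τ else 0 := by
      rw [lp.coeFn_sum, Finset.sum_apply]
      exact Finset.sum_pi_single τ (fun τ => A τ) S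
    rw [hA', lp.coeFn_sub, Pi.sub_apply, h1]
    split_ifs
    · exact sub_self _
    · exact sub_zero _
  have hnorm : ‖A'‖ ≤ ‖A‖ := by
    refine lp.norm_le_of_forall_le (norm_nonneg _) fun τ => ?_
    rw [happ]
    split_ifs
    · rw [norm_zero]
      exact norm_nonneg _
    · exact norm_apply_le_norm A τ
  have hzero : ∀ π ∈ F, B.toCLM A' π = 0 := by
    intro π hπ
    rw [toCLM_apply, B.component_congr (A' := 0)]
    · simp [component]
    · intro k
      rw [happ, if_pos (hS (Finset.mem_biUnion.2 ⟨π, hπ, Finset.mem_image_of_mem _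
        (Finset.mem_univ k)⟩))]
      rfl
  have h2 := hF (B.toCLM A')
  rw [Finset.sum_eq_zero fun π hπ => by rw [hzero π hπ, lp.single_zero, map_zero], sub_zero] at h2
  rw [dist_comm, dist_eq_norm]
  have h3 : ((φ : StrongDual ℂ (VN K)).comp B.toCLM) A -
      ∑ τ ∈ S, ((φ : StrongDual ℂ (VN K)).comp B.toCLM) (lp.single ∞ τ (A τ)) =
      (φ : StrongDual ℂ (VN K)) (B.toCLM A') := by
    rw [← map_sum, ← map_sub]
    rfl
  rw [h3]
  refine h2.trans_lt ?_
  rw [div_mul_eq_mul_div, div_lt_iff₀ hC]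
  refine mul_lt_mul_of_pos_left ?_ hε
  refine (B.norm_toCLM_apply_le A').trans_lt (mul_lt_mul_of_pos_left ?_ B.bound_pos)
  linarith

/-- The preadjoint map. -/
noncomputable def pull (φ : Predual K) : Predual G :=
  ⟨(φ : StrongDual ℂ (VN K)).comp B.toCLM, B.comp_toCLM_mem_predual φ⟩

theorem pull_apply (φ : Predual K) (A : VN G) :
    (B.pull φ : StrongDual ℂ (VN G)) A = (φ : StrongDual ℂ (VN K)) (B.toCLM A) := rfl

/-- Precomposition with `B.toCLM` multiplies any complete bound by at most `B.bound`. The strict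
form is the one that open unit balls require. -/
theorem matNormPredual_map_pull_lt {n : ℕ} {Φ : Matrix (Fin n) (Fin n) (Predual K)} {r : ℝ}
    (h : matNormPredual Φ < r) : matNormPredual (Φ.map B.pull) < B.bound * r := by
  obtain ⟨c, ⟨hc0, hc⟩, hcr⟩ := exists_lt_of_csInf_lt (cbBounds_nonempty Φ) h
  refine (matNormPredual_le (c := B.bound * c)
    ⟨mul_nonneg B.bound_pos.le hc0, fun m T => ?_⟩).trans_lt (mul_lt_mul_of_pos_left hcr B.bound_pos)
  refine (hc m (T.map B.toCLM)).trans ?_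
  rw [mul_comm B.bound, mul_assoc]
  exact mul_le_mul_of_nonneg_left (B.matNormVN_map_le T) hc0

end BlockMap

end BlockMap

/-! ### Norms in the Beurling–Fourier algebra as infima over representing functionals. -/

section MatNorm

variable {G : Type u} [Group G] [TopologicalSpace G] {ω : Dual G → ℝ}

theorem matNorm_le_of_represents (hω : IsCentralWeight ω) {n : ℕ}
    {F : Matrix (Fin n) (Fin n) (BFAlgebra hω)} {Φ : Matrix (Fin n) (Fin n) (Predual G)}
    (h : ∀ i j, Represents hω (Φ i j) (F i j)) : matNorm hω F ≤ matNormPredual Φ :=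
  csInf_le ⟨0, by rintro _ ⟨Ψ, -, rfl⟩; exact matNormPredual_nonneg Ψ⟩ ⟨Φ, h, rfl⟩

/-- Near-optimal representing functionals are enough, so their uniqueness is never needed. -/
theorem exists_represents_of_matNorm_lt (hω : IsCentralWeight ω) {n : ℕ}
    {F : Matrix (Fin n) (Fin n) (BFAlgebra hω)} {r : ℝ} (h : matNorm hω F < r) :
    ∃ Φ : Matrix (Fin n) (Fin n) (Predual G),
      (∀ i j, Represents hω (Φ i j) (F i j)) ∧ matNormPredual Φ < r := by
  choose Φ hΦ using fun i j => (F i j).2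
  obtain ⟨_, ⟨Ψ, hΨ, rfl⟩, hlt⟩ := exists_lt_of_csInf_lt (Set.Nonempty.image matNormPredual
    (s := {Φ | ∀ i j, Represents hω (Φ i j) (F i j)}) ⟨Matrix.of Φ, hΦ⟩) h
  exact ⟨Ψ, hΨ, hlt⟩

end MatNorm

/-! ### The two block maps between `VN(H)` and `VN(G)`. -/

section Restriction

variable {G : Type u} [Group G] [TopologicalSpace G] {ω : Dual G → ℝ} {H : Subgroup G}

/-- The normal complete contraction `VN(H) → VN(G)` that carries `λ(h) W_H⁻¹` to `λ(h) W⁻¹`. -/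
theorem exists_blockMap_inclusion (hω : IsCentralWeight ω)
    (hωH : IsCentralWeight (restrictWeight ω H)) :
    ∃ B : BlockMap H G, B.bound = 1 ∧ ∀ h : H,
      B.toCLM (lam h * invWeight hωH) = lam (h : G) * invWeight hω := by
  choose ix ft src V hV hVi hs using fun π : Dual G => (π.rep.restrict H).hasDecomposition
  have hext : ∀ (π : Dual G) (k : ix π), π.Extends (src π k) := fun π k => ⟨V π k, hV π k, hVi π k⟩
  refine ⟨{
    index := ix
    fintype := ft
    source := src
    -- The ratio exchanges `W_H⁻¹` for `W⁻¹`; it is at most 1 because `π` extends each constituent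
    -- of its restriction.
    coef := fun π k => restrictWeight ω H (src π k) / ω π
    emb := V
    sum_emb := hs
    bound := 1
    coef_nonneg := fun π k => div_nonneg (hωH.pos _).le (hω.pos _).le
    coef_le := fun π k => (div_le_one (hω.pos _)).2 (restrictWeight_le hω (hext π k))
    bound_pos := one_pos }, rfl, fun h => ?_⟩
  apply lp.ext
  funext π
  rw [BlockMap.toCLM_apply, lam_mul_invWeight_apply]
  simp only [BlockMap.component, lam_mul_invWeight_apply]
  rw [show π.rep.mat h = (π.rep.restrict H).mat h from rfl,
    UnitaryRep.mat_eq_sum_of_decomposition _ (hVi π) (hs π), Finset.smul_sum]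
  refine Finset.sum_congr rfl fun k _ => ?_
  have h0 : (restrictWeight ω H (src π k) : ℂ) ≠ 0 := Complex.ofReal_ne_zero.2 (hωH.pos _).ne'
  have h1 : ((restrictWeight ω H (src π k) / ω π : ℝ) : ℂ) *
      (restrictWeight ω H (src π k) : ℂ)⁻¹ = (ω π : ℂ)⁻¹ := by
    push_cast
    field_simp
  rw [smul_smul, h1, Matrix.mul_smul, Matrix.smul_mul]

variable [IsTopologicalGroup G] [CompactSpace G] [T2Space G]

/-- For `t > 1`, a normal map `VN(G) → VN(H)` of completely bounded norm at most `t` that carries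
`λ(h) W⁻¹` to `λ(h) W_H⁻¹` for `h ∈ H`. -/
theorem exists_blockMap_compression (hH : IsClosed (H : Set G)) (hω : IsCentralWeight ω)
    (hωH : IsCentralWeight (restrictWeight ω H)) {t : ℝ} (ht : 1 < t) :
    ∃ B : BlockMap G H, B.bound = t ∧ ∀ h : H,
      B.toCLM (lam (h : G) * invWeight hω) = lam h * invWeight hωH := by
  -- A nearly minimal extension of each `τ`; `t > 1` is needed because the infimum may not be
  -- attained.
  have hex : ∀ τ : Dual H, ∃ π : Dual G, π.Extends τ ∧ ω π < t * restrictWeight ω H τ :=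
    fun τ => exists_extends_lt hH (lt_mul_of_one_lt_left (hωH.pos τ) ht)
  choose π hπ hπt using hex
  choose V hV hVi using hπ
  refine ⟨{
    index := fun _ => Unit
    fintype := fun _ => inferInstance
    source := fun τ _ => π τ
    coef := fun τ _ => ω (π τ) / restrictWeight ω H τ
    -- A single block suffices: `V τ` is isometric, so its adjoint is a coisometry.
    emb := fun τ _ => (V τ)ᴴ
    sum_emb := fun τ => by
      rw [Fintype.sum_unique, Matrix.conjTranspose_conjTranspose]
      exact hV τ
    bound := t
    coef_nonneg := fun τ _ => div_nonneg (hω.pos _).le (hωH.pos _).le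
    coef_le := fun τ _ => (div_le_iff₀ (hωH.pos _)).2 (hπt τ).le
    bound_pos := one_pos.trans ht }, rfl, fun h => ?_⟩
  apply lp.ext
  funext τ
  rw [BlockMap.toCLM_apply, lam_mul_invWeight_apply]
  simp only [BlockMap.component, lam_mul_invWeight_apply]
  have h0 : (ω (π τ) : ℂ) ≠ 0 := Complex.ofReal_ne_zero.2 (hω.pos _).ne'
  have h1 : ((ω (π τ) / restrictWeight ω H τ : ℝ) : ℂ) * (ω (π τ) : ℂ)⁻¹ =
      (restrictWeight ω H τ : ℂ)⁻¹ := by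
    push_cast
    field_simp
  have h2 : (π τ).rep.mat (h : G) * V τ = V τ * τ.rep.mat h := (hVi τ h).symm
  rw [Fintype.sum_unique, smul_smul, h1, Matrix.mul_smul, Matrix.smul_mul,
    Matrix.conjTranspose_conjTranspose, Matrix.mul_assoc, h2, ← Matrix.mul_assoc, hV,
    Matrix.one_mul]

omit [IsTopologicalGroup G] [CompactSpace G] [T2Space G] in
variable (H) in
/-- The restriction of continuous functions to a subgroup. -/
noncomputable def restrictFun : C(G, ℂ) →ₗ[ℂ] C(H, ℂ) where
  toFun f := f.comp ⟨Subtype.val, continuous_subtype_val⟩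
  map_add' _ _ := rfl
  map_smul' _ _ := rfl

omit [IsTopologicalGroup G] [CompactSpace G] [T2Space G] in
theorem restrictFun_mem_trigPoly {f : C(G, ℂ)} (hf : f ∈ trigPoly G) :
    restrictFun H f ∈ trigPoly H := by
  rw [trigPoly_eq_span] at hf
  induction hf using Submodule.span_induction with
  | mem f hf =>
    obtain ⟨π, i, j, rfl⟩ := hf
    exact (π.rep.restrict H).coeff_mem_trigPoly i j
  | zero => rw [map_zero]; exact zero_mem _
  | add f g _ _ h h' => rw [map_add]; exact add_mem h h'
  | smul c f _ h => rw [map_smul]; exact Submodule.smul_mem _ _ h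

end Restriction

end BeurlingFourier

/-! ### The restriction theorem. -/

theorem propositionP {G : Type*} [Group G] [TopologicalSpace G] [IsTopologicalGroup G]
    [CompactSpace G] [T2Space G] (H : Subgroup G) (hH : IsClosed (H : Set G))
    (ω : BeurlingFourier.Dual G → ℝ) (hω : BeurlingFourier.IsCentralWeight ω) :
    ∃ hωH : BeurlingFourier.IsCentralWeight (BeurlingFourier.restrictWeight ω H),
      BeurlingFourier.trigPoly G ≤ BeurlingFourier.BFAlgebra hω ∧
      (∀ f ∈ BeurlingFourier.trigPoly G, f.restrict (H : Set G) ∈ BeurlingFourier.trigPoly H) ∧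
      ∃ R : BeurlingFourier.BFAlgebra hω →ₗ[ℂ] BeurlingFourier.BFAlgebra hωH,
        (∀ (f : BeurlingFourier.BFAlgebra hω) (h : H), (R f : C(H, ℂ)) h = (f : C(G, ℂ)) (h : G)) ∧
        BeurlingFourier.IsCompleteQuotientMap R := by
  have hωH := hω.restrictWeight hH
  refine ⟨hωH, BeurlingFourier.trigPoly_le_BFAlgebra hω,
    fun f hf => BeurlingFourier.restrictFun_mem_trigPoly hf, ?_⟩
  obtain ⟨N, hN1, hN⟩ := BeurlingFourier.exists_blockMap_inclusion hω hωH
  have hrep : ∀ {φ : BeurlingFourier.Predual G} {f : C(G, ℂ)},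
      BeurlingFourier.Represents hω φ f →
        BeurlingFourier.Represents hωH (N.pull φ) (BeurlingFourier.restrictFun H f) := by
    intro φ f hf h
    rw [N.pull_apply, hN]
    exact hf h
  have hmem : ∀ f ∈ BeurlingFourier.BFAlgebra hω,
      BeurlingFourier.restrictFun H f ∈ BeurlingFourier.BFAlgebra hωH := by
    rintro f ⟨φ, hφ⟩
    exact ⟨N.pull φ, hrep hφ⟩
  refine ⟨(BeurlingFourier.restrictFun H).restrict hmem, fun f h => rfl, fun n => ?_⟩
  ext F
  constructor
  · rintro ⟨F, hF, rfl⟩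
    obtain ⟨Φ, hΦ, hΦ1⟩ := BeurlingFourier.exists_represents_of_matNorm_lt hω hF
    have h1 := N.matNormPredual_map_pull_lt hΦ1
    rw [hN1, one_mul] at h1
    exact (BeurlingFourier.matNorm_le_of_represents hωH fun i j => hrep (hΦ i j)).trans_lt h1
  · intro hF
    obtain ⟨Ψ, hΨ, hΨ1⟩ := BeurlingFourier.exists_represents_of_matNorm_lt hωH hF
    -- With `matNormPredual Ψ < r < 1` and `t = r⁻¹`, the lift has norm less than `t r = 1`.
    obtain ⟨r, hr, hr1⟩ := exists_between hΨ1
    have hr0 : 0 < r := (BeurlingFourier.matNormPredual_nonneg Ψ).trans_lt hr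
    obtain ⟨P, hPt, hP⟩ := BeurlingFourier.exists_blockMap_compression hH hω hωH
      ((one_lt_inv₀ hr0).2 hr1)
    have h1 := P.matNormPredual_map_pull_lt hr
    rw [hPt, inv_mul_cancel₀ hr0.ne'] at h1
    -- The lift consists of the functions `s ↦ Ψ_{ij}(P(λ(s) W⁻¹))` on `G`; they restrict to `F`
    -- because `P` carries `λ(h) W⁻¹` to `λ(h) W_H⁻¹`.
    refine ⟨Matrix.of fun i j =>
      ⟨⟨_, BeurlingFourier.continuous_apply_lam_mul_invWeight hω (P.pull (Ψ i j))⟩,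
        P.pull (Ψ i j), fun s => rfl⟩, ?_, ?_⟩
    · exact (BeurlingFourier.matNorm_le_of_represents hω (Φ := Ψ.map P.pull)
        fun i j s => rfl).trans_lt h1
    · ext i j h
      change (P.pull (Ψ i j) : StrongDual ℂ (BeurlingFourier.VN G))
        (BeurlingFourier.lam (h : G) * BeurlingFourier.invWeight hω) = (F i j : C(H, ℂ)) h
      rw [P.pull_apply, hP, hΨ i j h]
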